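/- Let $(X,\omega)$ be a compact Kähler manifold of complex dimension $n$, $D\subset X$ a smooth divisor with associated holomorphic line bundle $L_D$ and defining section $s$ (so $s$ vanishes exactly on $D$, transversally), $h$ a smooth Hermitian metric on $L_D$ with curvature form $\theta$ ($\theta=-\sqrt{-1}\,\partial\bar\partial\log|\sigma|_h^2$ for a local holomorphic frame $\sigma$), and $\eta$ a smooth closed real $(1,1)$-form. Let $\gamma\in(0,1]$, $\alpha\in(0,1)$, $T>0$. Let $k>0$ be such that $\omega_\gamma=\omega+k\sqrt{-1}\,\partial\bar\partial|s|_h^{2\gamma}$ is positive on $X\setminus D$. Let $h_\gamma\in C^\infty(X)$ be such that, with the volume form $\Omega_\gamma=e^{-h_\gamma}\omega^n$ and $\mathrm{Ric}(\Omega_\gamma)=-\sqrt{-1}\,\partial\bar\partial\log\Omega_\gamma$, the forms $$\omega_{\gamma t}=\omega+t\bigl(-\mathrm{Ric}(\Omega_\gamma)+(1-\gamma)\theta+\eta\bigr)$$ are positive for all $t\in[0,T]$. Consider $$\frac{\partial\varphi}{\partial t}=\log\frac{(\omega_{\gamma t}+\sqrt{-1}\,\partial\bar\partial\varphi)^n}{\omega^n}+h_\gamma+(1-\gamma)\log|s|_h^2.\qquad(*)$$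 Let $C^{2,\alpha,\gamma}(X)$ be Donaldson's space of continuous functions on $X$ that are locally $C^{2,\alpha}$ off $D$ and such that, near each point of $D$, in holomorphic coordinates with $D=\{z_m=0\}$, the function and the components of its $\partial$ and $\partial\bar\partial$ in the coframe $|z_m|^{\gamma-1}dz_m$, $dz_i$ $(i\ne m)$ are $\alpha$-Hölder in the coordinates $|z_m|^{\gamma-1}z_m$, $z_i$ $(i\neq m)$, where for $\gamma<1$ the normal component of $\partial$ and the mixed components of $\partial\bar\partial$ vanish on $D$. For a continuous $\omega$-psh function $u_0$, a family $u(t)\in C^{2,\alpha,\gamma}(X)\cap C^\infty(X\setminus D)$, $t\in(0,T)$, differentiable in $t$ on $(0,T)\times(X\setminus D)$, is a subsolution (respectively supersolution) of $(*)$ with initial value $u_0$ if: 1. for all $0<\delta<T'<T$ there is a constant $C>0$ with $C^{-1}\omega_\gamma\le\omega_{\gamma t}+\sqrt{-1}\,\partial\bar\partial u(t)\le C\omega_\gamma$ on $X\setminus D$ for all $t\in(\delta,T')$; 2. on $(0,T)\times(X\setminus D)$, $\frac{\partial u}{\partial t}$ is $\le$ (respectively $\ge$) the right-hand side of $(*)$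 at $\varphi=u$; 3. $\lim_{t\to0^+}\|u(t)-u_0\|_{L^\infty(X)}=0$. Let $u$ be a subsolution of $(*)$ with initial value $u_0$ and $v$ a supersolution of $(*)$ with initial value $v_0$, where $u_0,v_0\in C^0(X)\cap\mathrm{PSH}(X,\omega)$. Then $$u(t,x)-v(t,x)\le\sup_X(u_0-v_0)\qquad\text{for all }t\in(0,T),\ x\in X.$$ -/

import Mathlib

open scoped Manifold ContDiff Topology ComplexOrder

noncomputable section

namespace ConicalFlow

/-! ### Wirtinger calculus on `ℂⁿ` -/

/-- `∂F/∂z_i = ½ (∂F/∂x_i - √-1 ∂F/∂y_i)`. -/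
def dz {n : ℕ} (i : Fin n) (F : (Fin n → ℂ) → ℂ) (z : Fin n → ℂ) : ℂ :=
  (1 / 2) * (fderiv ℝ F z (Pi.single i 1) - Complex.I * fderiv ℝ F z (Pi.single i Complex.I))

/-- `∂F/∂z̄_i = ½ (∂F/∂x_i + √-1 ∂F/∂y_i)`. -/
def dzbar {n : ℕ} (i : Fin n) (F : (Fin n → ℂ) → ℂ) (z : Fin n → ℂ) : ℂ :=
  (1 / 2) * (fderiv ℝ F z (Pi.single i 1) + Complex.I * fderiv ℝ F z (Pi.single i Complex.I))

/-- The complex Hessian `(∂²f/∂z_i∂z̄_j)`, i.e. the coefficient matrix of `√-1 ∂∂̄ f`. -/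
def complexHessian {n : ℕ} (f : (Fin n → ℂ) → ℝ) (z : Fin n → ℂ) : Matrix (Fin n) (Fin n) ℂ :=
  Matrix.of fun i j => dz i (fun w => dzbar j (fun y => (f y : ℂ)) w) z

/-- Continuous plurisubharmonic functions on a set `U ⊆ ℂⁿ` (sub-mean-value inequality on every
closed complex disc contained in `U`). -/
def IsContinuousPSHOn {n : ℕ} (f : (Fin n → ℂ) → ℝ) (U : Set (Fin n → ℂ)) : Prop :=
  ContinuousOn f U ∧
    ∀ a b : Fin n → ℂ, (∀ ζ : ℂ, ‖ζ‖ ≤ 1 → a + ζ • b ∈ U) →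
      f a ≤ Real.circleAverage (fun ζ : ℂ => f (a + ζ • b)) 0 1

/-! ### Real `(1,1)`-forms on a complex manifold

A form `√-1 ∑ a_{ij̄} dz_i ∧ dz̄_j` is given by its coefficient matrices in the charts of the atlas;
inequalities between real `(1,1)`-forms are inequalities between Hermitian matrices. -/

/-- A smooth real `(1,1)`-form: smooth Hermitian coefficient matrices in each chart of the atlas
with the tensorial transformation rule. The values of `coeff e` outside `e.target`, or for `e`
outside the atlas, are irrelevant. -/
structure RealOneOneForm (n : ℕ) (X : Type*) [TopologicalSpace X]
    [ChartedSpace (Fin n → ℂ) X] where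
  coeff : OpenPartialHomeomorph X (Fin n → ℂ) → (Fin n → ℂ) → Matrix (Fin n) (Fin n) ℂ
  smooth : ∀ e ∈ atlas (Fin n → ℂ) X, ∀ i j,
    ContDiffOn ℝ ∞ (fun z => coeff e z i j) e.target
  hermitian : ∀ e ∈ atlas (Fin n → ℂ) X, ∀ z ∈ e.target, (coeff e z).IsHermitian
  compat : ∀ e ∈ atlas (Fin n → ℂ) X, ∀ e' ∈ atlas (Fin n → ℂ) X,
    ∀ z ∈ e.target, e.symm z ∈ e'.source → ∀ i j,
      coeff e z i j = ∑ k, ∑ l,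
        coeff e' (e' (e.symm z)) k l *
          (fderiv ℂ (fun w => e' (e.symm w)) z (Pi.single i 1) k) *
          (starRingEnd ℂ) (fderiv ℂ (fun w => e' (e.symm w)) z (Pi.single j 1) l)

section Forms

variable {n : ℕ} {X : Type*} [TopologicalSpace X] [ChartedSpace (Fin n → ℂ) X]

/-- `dα = 0`; for a real `(1,1)`-form this is `∂_k a_{ij̄} = ∂_i a_{kj̄}`. -/
def RealOneOneForm.IsClosed (a : RealOneOneForm n X) : Prop :=
  ∀ e ∈ atlas (Fin n → ℂ) X, ∀ z ∈ e.target, ∀ i j k,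
    dz k (fun w => a.coeff e w i j) z = dz i (fun w => a.coeff e w k j) z

/-- Kähler forms: closed and positive. -/
def RealOneOneForm.IsKahler (a : RealOneOneForm n X) : Prop :=
  a.IsClosed ∧ ∀ e ∈ atlas (Fin n → ℂ) X, ∀ z ∈ e.target, (a.coeff e z).PosDef

/-- `f` is (real) `C^∞` on the open set `W ⊆ X`. -/
def SmoothOn (n : ℕ) {X : Type*} [TopologicalSpace X] [ChartedSpace (Fin n → ℂ) X]
    (f : X → ℝ) (W : Set X) : Prop :=
  ∀ e ∈ atlas (Fin n → ℂ) X,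
    ContDiffOn ℝ ∞ (fun z => f (e.symm z)) (e.target ∩ e.symm ⁻¹' W)

/-- `f ∈ C⁰(X) ∩ PSH(X, ωK)`: `f` is continuous, and `ρ + f` is plurisubharmonic for
every local potential `ρ` of `ωK`. -/
def IsContinuousOmegaPSH (ωK : RealOneOneForm n X) (f : X → ℝ) : Prop :=
  Continuous f ∧
    ∀ e ∈ atlas (Fin n → ℂ) X, ∀ U : Set (Fin n → ℂ), IsOpen U → U ⊆ e.target →
      ∀ ρ : (Fin n → ℂ) → ℝ, ContDiffOn ℝ ∞ ρ U →
        (∀ z ∈ U, complexHessian ρ z = ωK.coeff e z) →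
        IsContinuousPSHOn (fun z => ρ z + f (e.symm z)) U

/-- `Ric(Ω) = -√-1 ∂∂̄ log Ω` for the volume form `Ω = e^{-φ} ωK^n`, in the chart `e`. -/
def ricciForm (ωK : RealOneOneForm n X) (φ : X → ℝ)
    (e : OpenPartialHomeomorph X (Fin n → ℂ)) (z : Fin n → ℂ) : Matrix (Fin n) (Fin n) ℂ :=
  -complexHessian (fun w => Real.log (Real.exp (-φ (e.symm w)) * (ωK.coeff e w).det.re)) z

end Forms

/-! ### Hermitian holomorphic line bundles and smooth divisors -/

/-- A smooth Hermitian metric on a line bundle `L`, given by `normSq x ξ = |ξ|_h²`. -/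
structure HermitianMetric (n : ℕ) {X : Type*} [TopologicalSpace X] [ChartedSpace (Fin n → ℂ) X]
    (L : X → Type*) [∀ x, AddCommGroup (L x)] [∀ x, Module ℂ (L x)]
    [∀ x, TopologicalSpace (L x)] [TopologicalSpace (Bundle.TotalSpace ℂ L)]
    [FiberBundle ℂ L] [VectorBundle ℂ ℂ L] where
  normSq : ∀ x, L x → ℝ
  normSq_smul : ∀ (x : X) (c : ℂ) (ξ : L x), normSq x (c • ξ) = ‖c‖ ^ 2 * normSq x ξ
  normSq_pos : ∀ (x : X) (ξ : L x), ξ ≠ 0 → 0 < normSq x ξ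
  smooth : ∀ e ∈ atlas (Fin n → ℂ) X,
    ∀ (τ : Bundle.Trivialization ℂ (Bundle.TotalSpace.proj : Bundle.TotalSpace ℂ L → X))
      [MemTrivializationAtlas τ],
      ContDiffOn ℝ ∞ (fun z => normSq (e.symm z) (τ.symm (e.symm z) 1))
        (e.target ∩ e.symm ⁻¹' τ.baseSet)

section Bundles

variable {n : ℕ} {X : Type*} [TopologicalSpace X] [ChartedSpace (Fin n → ℂ) X]
  {L : X → Type*} [∀ x, AddCommGroup (L x)] [∀ x, Module ℂ (L x)]
  [∀ x, TopologicalSpace (L x)] [TopologicalSpace (Bundle.TotalSpace ℂ L)]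
  [FiberBundle ℂ L] [VectorBundle ℂ ℂ L]

/-- The curvature form `θ = -√-1 ∂∂̄ log |σ|_h²` of `h`, where `σ` is a local holomorphic frame,
in the chart `e`. -/
def curvature (h : HermitianMetric n L)
    (e : OpenPartialHomeomorph X (Fin n → ℂ)) (z : Fin n → ℂ) : Matrix (Fin n) (Fin n) ℂ :=
  -complexHessian (fun w => Real.log
    (h.normSq (e.symm w) ((trivializationAt ℂ L (e.symm z)).symm (e.symm w) 1))) z

/-- `s` is a defining section of the smooth divisor `D`: it is a holomorphic section of `L` whose
zero set is `D` and which vanishes transversally along `D`. Then `L` is the line bundle `L_D`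
associated with `D`. -/
def IsDefiningSection (n : ℕ) {X : Type*} [TopologicalSpace X] [ChartedSpace (Fin n → ℂ) X]
    {L : X → Type*} [∀ x, AddCommGroup (L x)] [∀ x, Module ℂ (L x)]
    [∀ x, TopologicalSpace (L x)] [TopologicalSpace (Bundle.TotalSpace ℂ L)]
    [FiberBundle ℂ L] [VectorBundle ℂ ℂ L] (s : ∀ x, L x) (D : Set X) : Prop :=
  ContMDiff 𝓘(ℂ, Fin n → ℂ) (𝓘(ℂ, Fin n → ℂ).prod 𝓘(ℂ, ℂ)) ω
      (fun x => (Bundle.TotalSpace.mk' ℂ x (s x) : Bundle.TotalSpace ℂ L)) ∧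
    (∀ x, x ∈ D ↔ s x = 0) ∧
    ∀ p ∈ D, fderiv ℂ (fun z => (trivializationAt ℂ L p
        (Bundle.TotalSpace.mk' ℂ ((chartAt (Fin n → ℂ) p).symm z)
          (s ((chartAt (Fin n → ℂ) p).symm z)))).2) (chartAt (Fin n → ℂ) p p) ≠ 0

/-- `ω_γ = ωK + k √-1 ∂∂̄ |s|_h^{2γ}` in the chart `e`. -/
def conicalForm (ωK : RealOneOneForm n X) (h : HermitianMetric n L) (s : ∀ x, L x) (γ k : ℝ)
    (e : OpenPartialHomeomorph X (Fin n → ℂ)) (z : Fin n → ℂ) : Matrix (Fin n) (Fin n) ℂ :=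
  ωK.coeff e z +
    (k : ℂ) • complexHessian (fun w => (h.normSq (e.symm w) (s (e.symm w))) ^ γ) z

/-- `ω_{γt} = ωK + t (-Ric(Ω_γ) + (1-γ) θ + η)` in the chart `e`, where `Ω_γ = e^{-hγ} ωK^n`. -/
def backgroundForm (ωK η : RealOneOneForm n X) (h : HermitianMetric n L) (hγ : X → ℝ) (γ t : ℝ)
    (e : OpenPartialHomeomorph X (Fin n → ℂ)) (z : Fin n → ℂ) : Matrix (Fin n) (Fin n) ℂ :=
  ωK.coeff e z +
    (t : ℂ) • (-ricciForm ωK hγ e z + ((1 - γ : ℝ) : ℂ) • curvature h e z + η.coeff e z)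

/-- `ω_{γt} + √-1 ∂∂̄ f` in the chart `e`. -/
def potentialForm (ωK η : RealOneOneForm n X) (h : HermitianMetric n L) (hγ : X → ℝ) (γ t : ℝ)
    (f : X → ℝ) (e : OpenPartialHomeomorph X (Fin n → ℂ)) (z : Fin n → ℂ) :
    Matrix (Fin n) (Fin n) ℂ :=
  backgroundForm ωK η h hγ γ t e z + complexHessian (fun w => f (e.symm w)) z

/-- The right-hand side
`log ((ω_{γt} + √-1 ∂∂̄ f)^n / ωK^n) + h_γ + (1-γ) log |s|_h²` in the chart `e`. -/
def mongeAmpereRHS (ωK η : RealOneOneForm n X) (h : HermitianMetric n L) (s : ∀ x, L x)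
    (hγ : X → ℝ) (γ t : ℝ) (f : X → ℝ)
    (e : OpenPartialHomeomorph X (Fin n → ℂ)) (z : Fin n → ℂ) : ℝ :=
  Real.log ((potentialForm ωK η h hγ γ t f e z).det.re / (ωK.coeff e z).det.re)
    + hγ (e.symm z) + (1 - γ) * Real.log (h.normSq (e.symm z) (s (e.symm z)))

end Bundles

/-! ### The conical Hölder space `C^{2,α,γ}(X)` -/

/-- The cone coordinates: `z_m` is replaced by `|z_m|^{γ-1} z_m`. -/
def coneCoord {n : ℕ} (γ : ℝ) (m : Fin n) (z : Fin n → ℂ) : Fin n → ℂ :=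
  Function.update z m (((‖z m‖ ^ (γ - 1) : ℝ) : ℂ) * z m)

/-- `F`, defined off `{z_m = 0}`, is `α`-Hölder on `U` in cone coordinates. -/
def ConeHolderOn {n : ℕ} (α γ : ℝ) (m : Fin n) (F : (Fin n → ℂ) → ℂ)
    (U : Set (Fin n → ℂ)) : Prop :=
  ∃ C : ℝ, ∀ z ∈ U, ∀ w ∈ U, z m ≠ 0 → w m ≠ 0 →
    ‖F z - F w‖ ≤ C * ‖coneCoord γ m z - coneCoord γ m w‖ ^ α

/-- `F` tends to `0` along `{z_m = 0}`. -/
def VanishesAlong {n : ℕ} (m : Fin n) (F : (Fin n → ℂ) → ℂ) (U : Set (Fin n → ℂ)) : Prop :=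
  ∀ p ∈ U, p m = 0 → Filter.Tendsto F (𝓝[{z | z m ≠ 0}] p) (𝓝 0)

/-- The factor which turns the coefficient of `dz_i` into the coefficient with respect to the cone
coframe `|z_m|^{γ-1} dz_m`, `dz_i` (`i ≠ m`). -/
def coneWeight {n : ℕ} (γ : ℝ) (m i : Fin n) (z : Fin n → ℂ) : ℂ :=
  if i = m then ((‖z m‖ ^ (1 - γ) : ℝ) : ℂ) else 1

/-- Coefficient of `∂f` in the cone coframe. -/
def coneGrad {n : ℕ} (γ : ℝ) (m i : Fin n) (f : (Fin n → ℂ) → ℝ) (z : Fin n → ℂ) : ℂ :=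
  coneWeight γ m i z * dz i (fun w => (f w : ℂ)) z

/-- Coefficient of `∂∂̄ f` in the cone coframe. -/
def coneHess {n : ℕ} (γ : ℝ) (m i j : Fin n) (f : (Fin n → ℂ) → ℝ) (z : Fin n → ℂ) : ℂ :=
  coneWeight γ m i z * coneWeight γ m j z * complexHessian f z i j

/-- Local condition along `{z_m = 0}`: `f`, `∂f` and `∂∂̄ f` have `α`-Hölder coefficients in
cone coordinates; for `γ < 1` the normal component of `∂f` and the mixed components of `∂∂̄ f`
vanish on `{z_m = 0}`. For `γ = 1` this is the usual Hölder condition on `f, ∂f, ∂∂̄ f`. -/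
def ConeC2On {n : ℕ} (α γ : ℝ) (m : Fin n) (f : (Fin n → ℂ) → ℝ)
    (U : Set (Fin n → ℂ)) : Prop :=
  ContDiffOn ℝ 2 f (U ∩ {z | z m ≠ 0}) ∧
    ConeHolderOn α γ m (fun z => (f z : ℂ)) U ∧
    (∀ i, ConeHolderOn α γ m (coneGrad γ m i f) U) ∧
    (∀ i j, ConeHolderOn α γ m (coneHess γ m i j f) U) ∧
    (γ < 1 → VanishesAlong m (coneGrad γ m m f) U ∧
      ∀ i, i ≠ m → VanishesAlong m (coneHess γ m i m f) U ∧
        VanishesAlong m (coneHess γ m m i f) U)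

/-- `f ∈ C^{2,α,γ}(X)`: `f` is continuous, `C^{2,α}` near points off `D`, and near each point of
`D` it satisfies the conical condition in a holomorphic chart in which `D = {z_m = 0}`. -/
def IsConeC2 (n : ℕ) {X : Type*} [TopologicalSpace X] [ChartedSpace (Fin n → ℂ) X]
    (D : Set X) (α γ : ℝ) (f : X → ℝ) : Prop :=
  Continuous f ∧
    (∀ p ∉ D, ∃ U : Set (Fin n → ℂ), IsOpen U ∧ chartAt (Fin n → ℂ) p p ∈ U ∧
      U ⊆ (chartAt (Fin n → ℂ) p).target ∧
      ContDiffOn ℝ 2 (fun z => f ((chartAt (Fin n → ℂ) p).symm z)) U ∧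
      ∃ C : ℝ, ∀ z ∈ U, ∀ w ∈ U,
        ‖iteratedFDeriv ℝ 2 (fun y => f ((chartAt (Fin n → ℂ) p).symm y)) z -
          iteratedFDeriv ℝ 2 (fun y => f ((chartAt (Fin n → ℂ) p).symm y)) w‖
            ≤ C * ‖z - w‖ ^ α) ∧
    (∀ p ∈ D, ∃ e ∈ IsManifold.maximalAtlas 𝓘(ℂ, Fin n → ℂ) ω X, ∃ m : Fin n,
      p ∈ e.source ∧ (∀ z ∈ e.target, e.symm z ∈ D ↔ z m = 0) ∧
      ∃ U : Set (Fin n → ℂ), IsOpen U ∧ e p ∈ U ∧ U ⊆ e.target ∧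
        ConeC2On α γ m (fun z => f (e.symm z)) U)

/-! ### Sub- and supersolutions -/

section Solutions

variable {n : ℕ} {X : Type*} [TopologicalSpace X] [ChartedSpace (Fin n → ℂ) X]
  {L : X → Type*} [∀ x, AddCommGroup (L x)] [∀ x, Module ℂ (L x)]
  [∀ x, TopologicalSpace (L x)] [TopologicalSpace (Bundle.TotalSpace ℂ L)]
  [FiberBundle ℂ L] [VectorBundle ℂ ℂ L]

/-- The conditions shared by sub- and supersolutions `u` on `(0,T) × X` with initial value `u₀`:
`u₀ ∈ C⁰(X) ∩ PSH(X, ωK)`; `u(t) ∈ C^{2,α,γ}(X) ∩ C^∞(X \ D)` for `t ∈ (0,T)`, and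
`∂u/∂t` exists on `(0,T) × (X \ D)`; for `0 < δ < T' < T` there is `C > 0` with
`C⁻¹ ω_γ ≤ ω_{γt} + √-1 ∂∂̄ u(t) ≤ C ω_γ` on `X \ D` for `t ∈ (δ,T')`;
and `u(t) → u₀` uniformly as `t → 0⁺`. -/
structure IsAdmissible (ωK η : RealOneOneForm n X) (D : Set X) (h : HermitianMetric n L)
    (s : ∀ x, L x) (hγ : X → ℝ) (α γ k T : ℝ) (u₀ : X → ℝ) (u : ℝ → X → ℝ) : Prop where
  initial_psh : IsContinuousOmegaPSH ωK u₀
  regular : ∀ t ∈ Set.Ioo 0 T, IsConeC2 n D α γ (u t) ∧ SmoothOn n (u t) Dᶜ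
  time_diff : ∀ t ∈ Set.Ioo 0 T, ∀ x ∉ D, DifferentiableAt ℝ (fun τ => u τ x) t
  equivalent : ∀ δ T' : ℝ, 0 < δ → δ < T' → T' < T → ∃ C : ℝ, 0 < C ∧
    ∀ t ∈ Set.Ioo δ T', ∀ e ∈ atlas (Fin n → ℂ) X, ∀ z ∈ e.target, e.symm z ∉ D →
      (potentialForm ωK η h hγ γ t (u t) e z -
        ((C⁻¹ : ℝ) : ℂ) • conicalForm ωK h s γ k e z).PosSemidef ∧
      ((C : ℂ) • conicalForm ωK h s γ k e z -
        potentialForm ωK η h hγ γ t (u t) e z).PosSemidef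
  initial : TendstoUniformly u u₀ (𝓝[>] 0)

/-- `u` is a subsolution on `(0,T) × X` with initial value `u₀`. -/
def IsSubsolution (ωK η : RealOneOneForm n X) (D : Set X) (h : HermitianMetric n L)
    (s : ∀ x, L x) (hγ : X → ℝ) (α γ k T : ℝ) (u₀ : X → ℝ) (u : ℝ → X → ℝ) : Prop :=
  IsAdmissible ωK η D h s hγ α γ k T u₀ u ∧
    ∀ t ∈ Set.Ioo 0 T, ∀ e ∈ atlas (Fin n → ℂ) X, ∀ z ∈ e.target, e.symm z ∉ D →
      deriv (fun τ => u τ (e.symm z)) t ≤ mongeAmpereRHS ωK η h s hγ γ t (u t) e z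

/-- `v` is a supersolution on `(0,T) × X` with initial value `v₀`. -/
def IsSupersolution (ωK η : RealOneOneForm n X) (D : Set X) (h : HermitianMetric n L)
    (s : ∀ x, L x) (hγ : X → ℝ) (α γ k T : ℝ) (v₀ : X → ℝ) (v : ℝ → X → ℝ) : Prop :=
  IsAdmissible ωK η D h s hγ α γ k T v₀ v ∧
    ∀ t ∈ Set.Ioo 0 T, ∀ e ∈ atlas (Fin n → ℂ) X, ∀ z ∈ e.target, e.symm z ∉ D →
      mongeAmpereRHS ωK η h s hγ γ t (v t) e z ≤ deriv (fun τ => v τ (e.symm z)) t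

end Solutions

end ConicalFlow

end

namespace ConicalFlow

open Matrix Filter Set
open scoped MatrixOrder

/- Let `ψ = log |s|_h² - k C |s|_h^{2γ}`, which tends to `-∞` along `D`. Off `D` the form
`√-1 ∂∂̄ log |s|_h²` is minus the curvature of `h`, hence at least `-C ω` for some `C`, so that
`√-1 ∂∂̄ ψ ≥ -C ω_γ`. For `ε > 0` the function `u - v + ε ψ` attains its maximum over `X ∖ D`, and
there `ω_u ≤ ω_v + ε C ω_γ ≤ (1 + ε C') ω_v`, so that `∂_t (u - v) ≤ n log (1 + ε C') ≤ ε n C'`.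
Hamilton's maximum principle bounds the growth of the maximum over compact time intervals by a
multiple of `ε`; then `ε → 0`, the initial time tends to `0`, and `X ∖ D` is dense. -/

/-! ### Hamilton's maximum principle -/

theorem le_of_forall_exists_left_le {α β : Type*} [ConditionallyCompleteLinearOrder α]
    [TopologicalSpace α] [OrderTopology α] [LinearOrder β] {g : α → β} {a b : α} (hab : a ≤ b)
    (husc : ∀ x ∈ Ico a b, UpperSemicontinuousWithinAt g (Ioi x) x)
    (hleft : ∀ x ∈ Ioc a b, ∃ y ∈ Ico a x, g x ≤ g y) : g b ≤ g a := by
  set S := {x ∈ Icc a b | g b ≤ g x}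
  have hbS : b ∈ S := ⟨right_mem_Icc.2 hab, le_rfl⟩
  have hbdd : BddBelow S := ⟨a, fun x hx => hx.1.1⟩
  have hac : a ≤ sInf S := le_csInf ⟨b, hbS⟩ fun x hx => hx.1.1
  have hcb : sInf S ≤ b := csInf_le hbdd hbS
  have hcS : g b ≤ g (sInf S) := by
    by_contra! hlt
    have hcb' : sInf S < b := hcb.lt_of_ne fun h => hlt.ne (congrArg g h)
    obtain ⟨d, hcd, hd⟩ := (mem_nhdsGT_iff_exists_Ioo_subset' hcb').1 (husc _ ⟨hac, hcb'⟩ _ hlt)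
    obtain ⟨x, hxS, hxd⟩ := exists_lt_of_csInf_lt ⟨b, hbS⟩ hcd
    rcases (csInf_le hbdd hxS).eq_or_lt with h | h
    · exact hlt.not_ge (h ▸ hxS.2)
    · exact (hd ⟨h, hxd⟩).not_ge hxS.2
  rcases hac.eq_or_lt with h | h
  · rwa [h]
  · obtain ⟨y, ⟨hay, hyc⟩, hy⟩ := hleft _ ⟨h, hcb⟩
    exact absurd (csInf_le hbdd ⟨⟨hay, hyc.le.trans hcb⟩, hcS.trans hy⟩) hyc.not_ge

theorem eventually_left_sub_lt_of_deriv_lt {f : ℝ → ℝ} {t c : ℝ} (hf : DifferentiableAt ℝ f t)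
    (h : deriv f t < c) : ∀ᶠ τ in 𝓝[<] t, f t - f τ < c * (t - τ) := by
  filter_upwards [hf.hasDerivAt.hasDerivWithinAt.limsup_slope_le' (self_notMem_Iio (a := t)) h,
    self_mem_nhdsWithin] with τ hτ hτt
  rw [slope_comm, slope_def_field, div_lt_iff₀ (sub_pos.2 hτt)] at hτ
  exact hτ

theorem sub_le_mul_of_deriv_le {f : ℝ → ℝ} {a b K : ℝ}
    (hf : ∀ t ∈ Icc a b, DifferentiableAt ℝ f t) (hK : ∀ t ∈ Icc a b, deriv f t ≤ K)
    {s t : ℝ} (hs : s ∈ Icc a b) (ht : t ∈ Icc a b) (hst : s ≤ t) :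
    f t - f s ≤ K * (t - s) :=
  (convex_Icc a b).image_sub_le_mul_sub_of_deriv_le
    (fun τ hτ => (hf τ hτ).continuousAt.continuousWithinAt)
    (fun τ hτ => (hf τ (interior_subset hτ)).differentiableWithinAt)
    (fun τ hτ => hK τ (interior_subset hτ)) s hs t ht hst

theorem max_le_add_mul_of_deriv_lt {ι : Type*} {w : ℝ → ι → ℝ} {p : ℝ → ι} {a b c K : ℝ}
    (hab : a ≤ b) (hdiff : ∀ t ∈ Icc a b, ∀ x, DifferentiableAt ℝ (w · x) t)
    (hK : ∀ t ∈ Icc a b, ∀ x, deriv (w · x) t ≤ K)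
    (hp : ∀ t ∈ Icc a b, ∀ x, w t x ≤ w t (p t))
    (hc : ∀ t ∈ Ioc a b, deriv (w · (p t)) t < c) :
    w b (p b) ≤ w a (p a) + c * (b - a) := by
  suffices w b (p b) - c * b ≤ w a (p a) - c * a by linarith
  refine le_of_forall_exists_left_le (g := fun t => w t (p t) - c * t) hab ?_ ?_
  · intro t ht y hy
    have hlim : Tendsto (fun τ => w t (p t) + K * (τ - t) - c * τ) (𝓝[>] t)
        (𝓝 (w t (p t) - c * t)) :=
      (Continuous.tendsto' (by fun_prop) _ _ (by ring)).mono_left nhdsWithin_le_nhds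
    filter_upwards [hlim.eventually_lt_const hy, Ioo_mem_nhdsGT ht.2] with τ hτ hτb
    have hτ' : τ ∈ Icc a b := ⟨ht.1.trans hτb.1.le, hτb.2.le⟩
    have ht' : t ∈ Icc a b := Ico_subset_Icc_self ht
    have hmvt := sub_le_mul_of_deriv_le (fun r hr => hdiff r hr (p τ))
      (fun r hr => hK r hr (p τ)) ht' hτ' hτb.1.le
    linarith [hp t ht' (p τ)]
  · intro t ht
    obtain ⟨τ, hlt, hτ⟩ := ((eventually_left_sub_lt_of_deriv_lt
      (hdiff t (Ioc_subset_Icc_self ht) (p t)) (hc t ht)).and (Ico_mem_nhdsLT ht.1)).exists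
    exact ⟨τ, hτ, by linarith [hp τ ⟨hτ.1, hτ.2.le.trans ht.2⟩ (p t)]⟩

theorem exists_forall_le_of_tendsto_cocompact_atBot {Y : Type*} [TopologicalSpace Y] [Nonempty Y]
    {f g : Y → ℝ} (hf : Continuous f) (hbdd : BddAbove (range f)) (hg : Continuous g)
    (hlim : Tendsto g (cocompact Y) atBot) : ∃ x, ∀ y, f y + g y ≤ f x + g x := by
  obtain ⟨C, hC⟩ := hbdd
  exact (hf.add hg).exists_forall_ge
    (tendsto_atBot_add_left_of_ge _ C (fun y => hC (mem_range_self y)) hlim)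

theorem le_of_deriv_le_mul_of_isMax {Y : Type*} [TopologicalSpace Y] {w : ℝ → Y → ℝ} {ψ : Y → ℝ}
    {a b A K M : ℝ} (hab : a ≤ b) (hψ : Continuous ψ) (hψlim : Tendsto ψ (cocompact Y) atBot)
    (hcont : ∀ t ∈ Icc a b, Continuous (w t)) (hbdd : ∀ t ∈ Icc a b, BddAbove (range (w t)))
    (hdiff : ∀ t ∈ Icc a b, ∀ x, DifferentiableAt ℝ (w · x) t)
    (hK : ∀ t ∈ Icc a b, ∀ x, deriv (w · x) t ≤ K)
    (hmax : ∀ t ∈ Icc a b, ∀ ε > 0, ∀ x, (∀ y, w t y + ε * ψ y ≤ w t x + ε * ψ x) →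
      deriv (w · x) t ≤ ε * A)
    (hM : ∀ x, w a x ≤ M) (x : Y) : w b x ≤ M := by
  have : Nonempty Y := ⟨x⟩
  obtain ⟨x₀, hx₀⟩ := hψ.exists_forall_ge hψlim
  have hbound : ∀ ε > 0, w b x ≤ M + ε * (ψ x₀ - ψ x + (A + 1) * (b - a)) := by
    intro ε hε
    have hex : ∀ t ∈ Icc a b, ∃ q, ∀ y, w t y + ε * ψ y ≤ w t q + ε * ψ q := fun t ht =>
      exists_forall_le_of_tendsto_cocompact_atBot (hcont t ht) (hbdd t ht) (hψ.const_mul ε)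
        (hψlim.const_mul_atBot hε)
    choose! p hp using hex
    have hHamilton := max_le_add_mul_of_deriv_lt (w := fun t y => w t y + ε * ψ y) (p := p)
      (c := ε * (A + 1)) hab (fun t ht y => (hdiff t ht y).add_const _)
      (fun t ht y => by simpa only [deriv_add_const] using hK t ht y) hp
      (fun t ht => by
        have ht' := Ioc_subset_Icc_self ht
        simpa only [deriv_add_const] using
          (hmax t ht' ε hε (p t) (hp t ht')).trans_lt (by linarith))
    linarith [hp b (right_mem_Icc.2 hab) x, hM (p a),
      mul_le_mul_of_nonneg_left (hx₀ (p a)) hε.le]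
  have hlim : Tendsto (fun ε => M + ε * (ψ x₀ - ψ x + (A + 1) * (b - a))) (𝓝[>] 0) (𝓝 M) :=
    (Continuous.tendsto' (by fun_prop) _ _ (by ring)).mono_left nhdsWithin_le_nhds
  exact ge_of_tendsto hlim (eventually_mem_nhdsWithin.mono hbound)

theorem tendsto_cocompact_subtype {X β : Type*} [TopologicalSpace X] [CompactSpace X]
    [TopologicalSpace β] {f : X → β} (hf : Continuous f) {W : Set X} {z : β}
    (hz : ∀ x ∉ W, f x = z) : Tendsto (fun x : W => f x) (cocompact W) (𝓝 z) := by
  refine (nhds_basis_opens z).ge_iff.2 fun V ⟨hzV, hV⟩ => mem_cocompact.2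
    ⟨(fun x : W => f x) ⁻¹' Vᶜ, ?_, fun x hx => not_not.1 hx⟩
  refine Topology.IsInducing.subtypeVal.isCompact_preimage' (K := f ⁻¹' Vᶜ)
    (hV.isClosed_compl.preimage hf).isCompact fun x hx => ?_
  rw [Subtype.range_coe]
  by_contra hxW
  exact hx ((hz x hxW).symm ▸ hzV : f x ∈ V)

theorem exists_forall_of_eventually {X ι : Type*} [TopologicalSpace X] [CompactSpace X]
    [Preorder ι] [IsDirectedOrder ι] [Nonempty ι] {P : ι → X → Prop}
    (hP : ∀ x, Monotone (P · x)) (hloc : ∀ x, ∃ c, ∀ᶠ y in 𝓝 x, P c y) : ∃ c, ∀ x, P c x := by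
  suffices ∃ c, ∀ x ∈ univ, P c x by simpa only [mem_univ, true_imp_iff] using this
  refine isCompact_univ.induction_on (p := fun s => ∃ c, ∀ x ∈ s, P c x) ?_ ?_ ?_ ?_
  · exact ⟨Classical.arbitrary ι, fun x hx => hx.elim⟩
  · exact fun s t hst ⟨c, hc⟩ => ⟨c, fun x hx => hc x (hst hx)⟩
  · rintro s t ⟨c, hc⟩ ⟨d, hd⟩
    obtain ⟨m, hcm, hdm⟩ := exists_ge_ge c d
    exact ⟨m, fun x hx => hx.elim (fun h => hP x hcm (hc x h)) fun h => hP x hdm (hd x h)⟩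
  · exact fun x _ => (hloc x).elim fun c hc =>
      ⟨{y | P c y}, mem_nhdsWithin_of_mem_nhds hc, c, fun y hy => hy⟩

/-! ### Positive definite matrices -/

open scoped Matrix.Norms.L2Operator in
theorem one_le_det_of_one_le {m : Type*} [Fintype m] [DecidableEq m] {A : Matrix m m ℂ}
    (hA : 1 ≤ A) : 1 ≤ A.det := by
  have hH : A.IsHermitian := (zero_le_one.trans hA).posSemidef.isHermitian
  have heig : ∀ i, 1 ≤ hH.eigenvalues i := fun i =>
    (algebraMap_le_iff_le_spectrum (R := ℝ) (a := A) (ha := hH)).1 (by simpa using hA) _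
      (hH.eigenvalues_mem_spectrum_real i)
  rw [hH.det_eq_prod_eigenvalues]
  exact Finset.one_le_prod fun i _ => by simpa using RCLike.ofReal_le_ofReal (K := ℂ) |>.2 (heig i)

open scoped Matrix.Norms.L2Operator in
theorem det_le_det_of_posDef_of_le {m : Type*} [Fintype m] [DecidableEq m] {A B : Matrix m m ℂ}
    (hA : A.PosDef) (hAB : A ≤ B) : A.det ≤ B.det := by
  set R := A ^ (-(1 / 2) : ℝ)
  have hR : IsSelfAdjoint R := .of_nonneg CFC.rpow_nonneg
  have hRAR : R * A * R = 1 := CFC.conjugate_rpow_neg_one_half A hA.isStrictlyPositive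
  have hone : 1 ≤ (R * B * R).det :=
    one_le_det_of_one_le (hRAR ▸ hR.conjugate_le_conjugate hAB)
  have hdet : R.det * A.det * R.det = 1 := by rw [← det_mul, ← det_mul, hRAR, det_one]
  calc A.det ≤ A.det * (R * B * R).det := le_mul_of_one_le_right hA.det_pos.le hone
    _ = B.det := by rw [det_mul, det_mul]; linear_combination B.det * hdet

theorem det_re_pos {m : Type*} [Fintype m] [DecidableEq m] {A : Matrix m m ℂ} (hA : A.PosDef) :
    0 < A.det.re :=
  (Complex.pos_iff.1 hA.det_pos).1

theorem log_det_le_of_le_smul {m : Type*} [Fintype m] [DecidableEq m] {A B : Matrix m m ℂ}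
    (hA : A.PosDef) (hB : B.PosDef) {c : ℝ} (hc : 0 < c) (hAB : A ≤ c • B) :
    Real.log A.det.re ≤ Fintype.card m * Real.log c + Real.log B.det.re := by
  have hle : A.det.re ≤ c ^ Fintype.card m * B.det.re := by
    have h := (Complex.le_def.1 (det_le_det_of_posDef_of_le hA hAB)).1
    rwa [← Complex.coe_smul c B, det_smul, ← Complex.ofReal_pow, Complex.re_ofReal_mul] at h
  have hB0 := det_re_pos hB
  calc Real.log A.det.re ≤ Real.log (c ^ Fintype.card m * B.det.re) :=
        Real.log_le_log (det_re_pos hA) hle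
    _ = _ := by rw [Real.log_mul (by positivity) hB0.ne', Real.log_pow]

theorem eventually_le_smul_of_isStrictlyPositive {Y 𝓐 : Type*} [TopologicalSpace Y]
    [CStarAlgebra 𝓐] [PartialOrder 𝓐] [StarOrderedRing 𝓐] {a b : Y → 𝓐} {z : Y}
    (ha : ContinuousAt a z) (hb : ContinuousAt b z) (ha_sa : ∀ᶠ w in 𝓝 z, IsSelfAdjoint (a w))
    (hb_sa : ∀ᶠ w in 𝓝 z, IsSelfAdjoint (b w)) (hz : IsStrictlyPositive (a z)) :
    ∃ C : ℝ, 0 ≤ C ∧ ∀ᶠ w in 𝓝 z, b w ≤ C • a w := by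
  rcases subsingleton_or_nontrivial 𝓐
  · exact ⟨0, le_rfl, .of_forall fun w => (Subsingleton.elim _ _).le⟩
  obtain ⟨r, hr, hra⟩ := (CFC.exists_pos_algebraMap_le_iff hz.nonneg.isSelfAdjoint).2
    fun x hx => hz.spectrum_pos hx
  have hnear : ∀ᶠ w in 𝓝 z, ‖a z - a w‖ < r / 2 :=
    ((ha.const_sub (a z)).norm.eventually_lt_const (by simpa using half_pos hr))
  refine ⟨(‖b z‖ + 1) / (r / 2), by positivity, ?_⟩
  filter_upwards [hnear, hb.norm.eventually_lt_const (lt_add_one _), ha_sa, hb_sa]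
    with w hw hbw haw hbw_sa
  have hlower : algebraMap ℝ 𝓐 (r / 2) ≤ a w := by
    have hdiff : a z - a w ≤ algebraMap ℝ 𝓐 (r / 2) :=
      ((hz.nonneg.isSelfAdjoint.sub haw).le_algebraMap_norm_self).trans
        (algebraMap_mono 𝓐 hw.le)
    calc algebraMap ℝ 𝓐 (r / 2) = algebraMap ℝ 𝓐 r - algebraMap ℝ 𝓐 (r / 2) := by
          rw [← map_sub, sub_half]
      _ ≤ a z - (a z - a w) := sub_le_sub hra hdiff
      _ = a w := sub_sub_cancel _ _
  calc b w ≤ algebraMap ℝ 𝓐 (‖b z‖ + 1) :=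
        hbw_sa.le_algebraMap_norm_self.trans (algebraMap_mono 𝓐 hbw.le)
    _ = ((‖b z‖ + 1) / (r / 2)) • algebraMap ℝ 𝓐 (r / 2) := by
        rw [Algebra.algebraMap_eq_smul_one (r / 2), smul_smul,
          ← Algebra.algebraMap_eq_smul_one, div_mul_cancel₀ _ (by positivity)]
    _ ≤ ((‖b z‖ + 1) / (r / 2)) • a w := smul_le_smul_of_nonneg_left hlower (by positivity)

theorem eventually_le_smul_of_posDef {Y m : Type*} [TopologicalSpace Y] [Finite m]
    {A B : Y → Matrix m m ℂ} {z : Y} (hA : ContinuousAt A z)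
    (hB : ContinuousAt B z) (hApos : ∀ᶠ w in 𝓝 z, (A w).PosDef)
    (hBherm : ∀ᶠ w in 𝓝 z, (B w).IsHermitian) :
    ∃ C : ℝ, 0 ≤ C ∧ ∀ᶠ w in 𝓝 z, B w ≤ C • A w := by
  classical
  cases nonempty_fintype m
  open scoped Matrix.Norms.L2Operator in
  exact eventually_le_smul_of_isStrictlyPositive hA hB (hApos.mono fun w hw => hw.isHermitian)
    hBherm hApos.self_of_nhds.isStrictlyPositive

/-! ### The complex Hessian of a real function -/

section SesquilinearPart

variable {E : Type*} [NormedAddCommGroup E] [NormedSpace ℂ E] [NormedSpace ℝ E]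
  [IsScalarTower ℝ ℂ E]

theorem smul_eq_re_add_im_smul_I (c : ℂ) (x : E) :
    c • x = c.re • x + c.im • (Complex.I • x) := by
  conv_lhs => rw [← Complex.re_add_im c, add_smul, mul_smul]
  rw [← algebraMap_smul ℂ c.re x, ← algebraMap_smul ℂ c.im (Complex.I • x), Complex.coe_algebraMap]

/-- The complex sesquilinear part
`B(x, y) + B(√-1 x, √-1 y) + √-1 (B(x, √-1 y) - B(√-1 x, y))` of a real bilinear form `B` on a
complex vector space. Applied to `D²f` it gives four times the complex Hessian of `f`. -/
noncomputable def sesquilinearPart (B : E →L[ℝ] E →L[ℝ] ℝ) : E →ₗ[ℂ] E →ₗ⋆[ℂ] ℂ :=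
  LinearMap.mk₂'ₛₗ (RingHom.id ℂ) (starRingEnd ℂ)
    (fun x y => ((B x y + B (Complex.I • x) (Complex.I • y) : ℝ) : ℂ) +
      Complex.I * ((B x (Complex.I • y) - B (Complex.I • x) y : ℝ) : ℂ))
    (fun x x' y => by
      simp only [smul_add, map_add, _root_.add_apply]; push_cast; ring)
    (fun c x y => by
      rw [smul_comm Complex.I c x]
      simp only [smul_eq_re_add_im_smul_I c, map_add, map_smul, _root_.add_apply,
        _root_.smul_apply, smul_smul, Complex.I_mul_I, neg_smul, one_smul, smul_eq_mul, map_neg,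
        _root_.neg_apply]
      apply Complex.ext <;> simp <;> ring)
    (fun x y y' => by
      simp only [smul_add, map_add]; push_cast; ring)
    (fun c x y => by
      rw [smul_comm Complex.I c y]
      simp only [smul_eq_re_add_im_smul_I c, map_add, map_smul, smul_smul,
        Complex.I_mul_I, neg_smul, one_smul, smul_eq_mul, map_neg]
      apply Complex.ext <;> simp <;> ring)

theorem sesquilinearPart_apply (B : E →L[ℝ] E →L[ℝ] ℝ) (x y : E) :
    sesquilinearPart B x y = ((B x y + B (Complex.I • x) (Complex.I • y) : ℝ) : ℂ) +
      Complex.I * ((B x (Complex.I • y) - B (Complex.I • x) y : ℝ) : ℂ) :=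
  rfl

theorem star_sesquilinearPart {B : E →L[ℝ] E →L[ℝ] ℝ} (hB : ∀ x y, B x y = B y x) (x y : E) :
    star (sesquilinearPart B x y) = sesquilinearPart B y x := by
  simp only [sesquilinearPart_apply, hB y, hB (Complex.I • y)]
  apply Complex.ext <;> simp

theorem sesquilinearPart_self_nonpos {B : E →L[ℝ] E →L[ℝ] ℝ} (hB : ∀ x y, B x y = B y x)
    (hneg : ∀ x, B x x ≤ 0) (x : E) : sesquilinearPart B x x ≤ 0 := by
  rw [sesquilinearPart_apply, hB (Complex.I • x) x, sub_self, Complex.ofReal_zero, mul_zero,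
    add_zero]
  exact_mod_cast add_nonpos (hneg x) (hneg _)

end SesquilinearPart

section SecondDerivative

variable {E : Type*} [NormedAddCommGroup E] [NormedSpace ℝ E] {f g : E → ℝ} {z : E}

theorem eventually_differentiableAt (hf : ContDiffAt ℝ 2 f z) :
    ∀ᶠ w in 𝓝 z, DifferentiableAt ℝ f w :=
  (hf.eventually (by simp)).mono fun _ h => h.differentiableAt two_ne_zero

theorem differentiableAt_fderiv (hf : ContDiffAt ℝ 2 f z) : DifferentiableAt ℝ (fderiv ℝ f) z :=
  (hf.fderiv_right (m := 1) (by norm_num)).differentiableAt one_ne_zero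

theorem fderiv_fderiv_comm (hf : ContDiffAt ℝ 2 f z) (x y : E) :
    fderiv ℝ (fderiv ℝ f) z x y = fderiv ℝ (fderiv ℝ f) z y x :=
  (hf.isSymmSndFDerivAt (by simp)).eq x y

theorem fderiv_ofReal_comp (hf : DifferentiableAt ℝ f z) (v : E) :
    fderiv ℝ (fun y => (f y : ℂ)) z v = (fderiv ℝ f z v : ℂ) :=
  congrArg (· v) (Complex.ofRealCLM.hasFDerivAt.comp z hf.hasFDerivAt).fderiv

theorem hasFDerivAt_ofReal_fderiv_apply (hf : ContDiffAt ℝ 2 f z) (v : E) :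
    HasFDerivAt (fun w => (fderiv ℝ f w v : ℂ))
      (Complex.ofRealCLM.comp ((fderiv ℝ (fderiv ℝ f) z).flip v)) z := by
  have h : HasFDerivAt (fun w => fderiv ℝ f w v) ((fderiv ℝ (fderiv ℝ f) z).flip v) z := by
    simpa using (differentiableAt_fderiv hf).hasFDerivAt.clm_apply (hasFDerivAt_const v z)
  exact Complex.ofRealCLM.hasFDerivAt.comp z h

theorem fderiv_fderiv_add (hf : ContDiffAt ℝ 2 f z) (hg : ContDiffAt ℝ 2 g z) :
    fderiv ℝ (fderiv ℝ (f + g)) z = fderiv ℝ (fderiv ℝ f) z + fderiv ℝ (fderiv ℝ g) z := by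
  have h : fderiv ℝ (f + g) =ᶠ[𝓝 z] fderiv ℝ f + fderiv ℝ g := by
    filter_upwards [eventually_differentiableAt hf, eventually_differentiableAt hg] with w hfw hgw
      using fderiv_add hfw hgw
  rw [h.fderiv_eq, fderiv_add (differentiableAt_fderiv hf) (differentiableAt_fderiv hg)]

theorem fderiv_fderiv_const_smul (hf : ContDiffAt ℝ 2 f z) (c : ℝ) :
    fderiv ℝ (fderiv ℝ (c • f)) z = c • fderiv ℝ (fderiv ℝ f) z := by
  have h : fderiv ℝ (c • f) =ᶠ[𝓝 z] c • fderiv ℝ f := by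
    filter_upwards [eventually_differentiableAt hf] with w hfw using fderiv_const_smul hfw c
  rw [h.fderiv_eq, fderiv_const_smul (differentiableAt_fderiv hf)]

theorem deriv_deriv_nonpos_of_isLocalMax {φ : ℝ → ℝ} {a : ℝ} (hc : ContinuousAt φ a)
    (h : IsLocalMax φ a) : deriv (deriv φ) a ≤ 0 := by
  by_contra! hpos
  have hmin := isLocalMin_of_deriv_deriv_pos hpos h.deriv_eq_zero hc
  have hconst : φ =ᶠ[𝓝 a] fun _ => φ a := by
    filter_upwards [h, hmin] with x hmax hmin using le_antisymm hmax hmin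
  rw [hconst.deriv.deriv_eq] at hpos
  simp at hpos

theorem deriv_deriv_comp_add_smul (hf : ContDiffAt ℝ 2 f z) (v : E) :
    deriv (deriv fun s : ℝ => f (z + s • v)) 0 = fderiv ℝ (fderiv ℝ f) z v v := by
  have hline : ∀ s : ℝ, HasDerivAt (fun s : ℝ => z + s • v) v s := fun s => by
    simpa only [id, one_smul] using ((hasDerivAt_id s).smul_const v).const_add z
  have hlim : Tendsto (fun s : ℝ => z + s • v) (𝓝 0) (𝓝 z) :=
    Continuous.tendsto' (by fun_prop) _ _ (by simp)
  have hfirst : deriv (fun s : ℝ => f (z + s • v)) =ᶠ[𝓝 0] fun s => fderiv ℝ f (z + s • v) v := by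
    filter_upwards [hlim.eventually (eventually_differentiableAt hf)] with s hs
    exact (hs.hasFDerivAt.comp_hasDerivAt s (hline s)).deriv
  have hsecond : HasDerivAt (fun s : ℝ => fderiv ℝ f (z + s • v)) (fderiv ℝ (fderiv ℝ f) z v) 0 :=
    (differentiableAt_fderiv hf).hasFDerivAt.comp_hasDerivAt_of_eq 0 (hline 0) (by simp)
  rw [hfirst.deriv_eq]
  simpa using (hsecond.clm_apply (hasDerivAt_const (0 : ℝ) v)).deriv

theorem fderiv_fderiv_nonpos_of_isLocalMax (hf : ContDiffAt ℝ 2 f z) (h : IsLocalMax f z) (v : E) :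
    fderiv ℝ (fderiv ℝ f) z v v ≤ 0 := by
  have hlim : Tendsto (fun s : ℝ => z + s • v) (𝓝 0) (𝓝 z) :=
    Continuous.tendsto' (by fun_prop) _ _ (by simp)
  rw [← deriv_deriv_comp_add_smul hf]
  refine deriv_deriv_nonpos_of_isLocalMax
    (ContinuousAt.comp (by simpa using hf.continuousAt) (by fun_prop)) ?_
  filter_upwards [hlim.eventually h] with s hs
  simpa using hs

end SecondDerivative

section ComplexHessian

variable {n : ℕ} {f g : (Fin n → ℂ) → ℝ} {z : Fin n → ℂ}

theorem complexHessian_apply (hf : ContDiffAt ℝ 2 f z) (i j : Fin n) :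
    complexHessian f z i j =
      (1 / 4) * sesquilinearPart (fderiv ℝ (fderiv ℝ f) z) (Pi.single i 1) (Pi.single j 1) := by
  have hdzbar : (fun w => dzbar j (fun y => (f y : ℂ)) w) =ᶠ[𝓝 z] fun w =>
      (1 / 2) * ((fderiv ℝ f w (Pi.single j 1) : ℂ) +
        Complex.I * (fderiv ℝ f w (Pi.single j Complex.I) : ℂ)) := by
    filter_upwards [eventually_differentiableAt hf] with w hw
    simp only [dzbar, fderiv_ofReal_comp hw]
  have hsecond := (((hasFDerivAt_ofReal_fderiv_apply hf (Pi.single j 1)).add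
    ((hasFDerivAt_ofReal_fderiv_apply hf (Pi.single j Complex.I)).const_mul
      Complex.I)).const_mul (1 / 2)).congr_of_eventuallyEq hdzbar
  have hI : ∀ l : Fin n, Complex.I • (Pi.single l 1 : Fin n → ℂ) = Pi.single l Complex.I := by
    simp [← Pi.single_smul]
  rw [complexHessian, Matrix.of_apply, dz, hsecond.fderiv, sesquilinearPart_apply, hI, hI]
  simp only [one_div, smul_add, _root_.add_apply, _root_.smul_apply,
    ContinuousLinearMap.comp_apply, ContinuousLinearMap.flip_apply, Complex.ofRealCLM_apply,
    smul_eq_mul, Complex.ofReal_add, Complex.ofReal_sub]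
  linear_combination (-1 / 4 : ℂ) * (fderiv ℝ (fderiv ℝ f) z (Pi.single i Complex.I)
    (Pi.single j Complex.I) : ℂ) * Complex.I_mul_I

theorem complexHessian_eq_toMatrix (hf : ContDiffAt ℝ 2 f z) :
    complexHessian f z = (1 / 4 : ℂ) • LinearMap.toMatrix₂ (Pi.basisFun ℂ (Fin n))
      (Pi.basisFun ℂ (Fin n)) (sesquilinearPart (fderiv ℝ (fderiv ℝ f) z)) := by
  ext i j
  simp [complexHessian_apply hf, LinearMap.toMatrix₂_apply]

theorem complexHessian_congr (h : f =ᶠ[𝓝 z] g) : complexHessian f z = complexHessian g z := by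
  ext i j
  have hdzbar : (fun w => dzbar j (fun y => (f y : ℂ)) w) =ᶠ[𝓝 z]
      fun w => dzbar j (fun y => (g y : ℂ)) w := by
    filter_upwards [h.eventuallyEq_nhds] with w hw
    have hcast : (fun y => (f y : ℂ)) =ᶠ[𝓝 w] fun y => (g y : ℂ) := hw.fun_comp Complex.ofReal
    simp only [dzbar, hcast.fderiv_eq]
  simp only [complexHessian, Matrix.of_apply, dz, hdzbar.fderiv_eq]

theorem complexHessian_add (hf : ContDiffAt ℝ 2 f z) (hg : ContDiffAt ℝ 2 g z) :
    complexHessian (f + g) z = complexHessian f z + complexHessian g z := by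
  have hfg : ContDiffAt ℝ 2 (f + g) z := hf.add hg
  ext i j
  rw [Matrix.add_apply, complexHessian_apply hf, complexHessian_apply hg,
    complexHessian_apply hfg, fderiv_fderiv_add hf hg]
  simp only [sesquilinearPart_apply, _root_.add_apply]
  push_cast
  ring

theorem complexHessian_const_smul (hf : ContDiffAt ℝ 2 f z) (c : ℝ) :
    complexHessian (c • f) z = c • complexHessian f z := by
  have hcf : ContDiffAt ℝ 2 (c • f) z := contDiffAt_const.smul hf
  ext i j
  rw [Matrix.smul_apply, complexHessian_apply hf, complexHessian_apply hcf,
    fderiv_fderiv_const_smul hf]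
  simp only [sesquilinearPart_apply, _root_.smul_apply, smul_eq_mul, Complex.real_smul]
  push_cast
  ring

theorem complexHessian_sub (hf : ContDiffAt ℝ 2 f z) (hg : ContDiffAt ℝ 2 g z) :
    complexHessian (f - g) z = complexHessian f z - complexHessian g z := by
  have hneg : ContDiffAt ℝ 2 ((-1 : ℝ) • g) z := contDiffAt_const.smul hg
  rw [sub_eq_add_neg, ← neg_one_smul ℝ g, complexHessian_add hf hneg,
    complexHessian_const_smul hg, neg_one_smul, ← sub_eq_add_neg]

theorem isHermitian_complexHessian (hf : ContDiffAt ℝ 2 f z) :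
    (complexHessian f z).IsHermitian := by
  ext i j
  rw [conjTranspose_apply, complexHessian_apply hf, complexHessian_apply hf, star_mul',
    star_sesquilinearPart (fderiv_fderiv_comm hf)]
  simp

theorem continuousAt_complexHessian (hf : ContDiffAt ℝ 2 f z) :
    ContinuousAt (complexHessian f) z := by
  have hD : ContinuousAt (fderiv ℝ (fderiv ℝ f)) z :=
    ((hf.fderiv_right (m := 1) (by norm_num)).fderiv_right (m := 0) (by norm_num)).continuousAt
  have heq : (fun w => Matrix.of fun i j => (1 / 4) *
      sesquilinearPart (fderiv ℝ (fderiv ℝ f) w) (Pi.single i 1) (Pi.single j 1)) =ᶠ[𝓝 z]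
      complexHessian f := by
    filter_upwards [hf.eventually (by simp)] with w hw
    ext i j
    rw [Matrix.of_apply, complexHessian_apply hw]
  refine ContinuousAt.congr (continuousAt_pi.2 fun i => continuousAt_pi.2 fun j => ?_) heq
  simp only [Matrix.of_apply, sesquilinearPart_apply]
  fun_prop

theorem star_dotProduct_complexHessian_mulVec (hf : ContDiffAt ℝ 2 f z) (ξ : Fin n → ℂ) :
    star ξ ⬝ᵥ complexHessian f z *ᵥ ξ =
      (1 / 4) * sesquilinearPart (fderiv ℝ (fderiv ℝ f) z) (star ξ) (star ξ) := by
  have h := dotProduct_toMatrix₂_mulVec (Pi.basisFun ℂ (Fin n)) (Pi.basisFun ℂ (Fin n))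
    (sesquilinearPart (fderiv ℝ (fderiv ℝ f) z)) (star ξ) (star ξ)
  have hξ : starRingEnd ℂ ∘ star ξ = ξ := funext fun i => star_star (ξ i)
  rw [hξ] at h
  rw [complexHessian_eq_toMatrix hf, smul_mulVec, dotProduct_smul, smul_eq_mul]
  exact congrArg _ h

theorem complexHessian_nonpos_of_isLocalMax (hf : ContDiffAt ℝ 2 f z) (h : IsLocalMax f z) :
    complexHessian f z ≤ 0 := by
  rw [Matrix.le_iff, zero_sub]
  refine .of_dotProduct_mulVec_nonneg (isHermitian_complexHessian hf).neg fun ξ => ?_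
  rw [neg_mulVec, dotProduct_neg, star_dotProduct_complexHessian_mulVec hf, neg_nonneg]
  exact mul_nonpos_of_nonneg_of_nonpos (by positivity) (sesquilinearPart_self_nonpos
    (fderiv_fderiv_comm hf) (fderiv_fderiv_nonpos_of_isLocalMax hf h) _)

theorem fderiv_fderiv_re {E : Type*} [NormedAddCommGroup E] [NormedSpace ℂ E] [NormedSpace ℝ E]
    [IsScalarTower ℝ ℂ E] {F : E → ℂ} {z : E} (hF : ContDiffAt ℂ 2 F z) (x y : E) :
    fderiv ℝ (fderiv ℝ fun w => (F w).re) z x y = (fderiv ℂ (fderiv ℂ F) z x y).re := by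
  let L : (E →L[ℂ] ℂ) →L[ℝ] E →L[ℝ] ℝ := (ContinuousLinearMap.compL ℝ E ℂ ℝ Complex.reCLM).comp
    (ContinuousLinearMap.restrictScalarsL ℂ E ℂ ℝ ℝ)
  have hfirst : fderiv ℝ (fun w => (F w).re) =ᶠ[𝓝 z] L ∘ fderiv ℂ F := by
    filter_upwards [hF.eventually (by simp)] with w hw
    exact (Complex.reCLM.hasFDerivAt.comp w
      ((hw.differentiableAt two_ne_zero).hasFDerivAt.restrictScalars ℝ)).fderiv
  have hsecond : DifferentiableAt ℂ (fderiv ℂ F) z :=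
    (hF.fderiv_right (m := 1) (by norm_num)).differentiableAt one_ne_zero
  rw [hfirst.fderiv_eq, (L.hasFDerivAt.comp z (hsecond.hasFDerivAt.restrictScalars ℝ)).fderiv]
  rfl

theorem complexHessian_re_eq_zero {F : (Fin n → ℂ) → ℂ} (hF : ContDiffAt ℂ 2 F z) :
    complexHessian (fun w => (F w).re) z = 0 := by
  have hre : ContDiffAt ℝ 2 (fun w => (F w).re) z :=
    Complex.reCLM.contDiff.contDiffAt.comp z (hF.restrict_scalars ℝ)
  ext i j
  rw [complexHessian_apply hre, sesquilinearPart_apply]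
  simp [fderiv_fderiv_re hF]

theorem complexHessian_log_norm_sq_eq_zero {c : (Fin n → ℂ) → ℂ} (hc : ContDiffAt ℂ 2 c z)
    (h0 : c z ≠ 0) : complexHessian (fun w => Real.log (‖c w‖ ^ 2)) z = 0 := by
  have hF : ContDiffAt ℂ 2
      (fun w => 2 * Complex.log (c w / c z) + 2 * (Real.log ‖c z‖ : ℂ)) z := by
    refine (contDiffAt_const.mul (ContDiffAt.comp z (Complex.contDiffAt_log ?_)
      (hc.div_const _))).add contDiffAt_const
    rw [div_self h0]
    exact Complex.one_mem_slitPlane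
  rw [← complexHessian_re_eq_zero hF]
  refine complexHessian_congr ?_
  filter_upwards [hc.continuousAt.eventually_ne h0] with w hw
  simp only [Real.log_pow, Nat.cast_ofNat, Complex.add_re, Complex.mul_re, Complex.re_ofNat,
    Complex.log_re, Complex.norm_div, Real.log_div (norm_ne_zero_iff.2 hw) (norm_ne_zero_iff.2 h0),
    Complex.im_ofNat, zero_mul, sub_zero, Complex.ofReal_re, Complex.ofReal_im, mul_zero]
  ring

end ComplexHessian

theorem complexHessian_le_add_of_isLocalMax {n : ℕ} {f g ψ : (Fin n → ℂ) → ℝ} {z : Fin n → ℂ}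
    {ε : ℝ} (hf : ContDiffAt ℝ 2 f z) (hg : ContDiffAt ℝ 2 g z) (hψ : ContDiffAt ℝ 2 ψ z)
    (hmax : IsLocalMax (f - g + ε • ψ) z) :
    complexHessian f z ≤ complexHessian g z + ε • -complexHessian ψ z := by
  have hεψ : ContDiffAt ℝ 2 (ε • ψ) z := contDiffAt_const.smul hψ
  have hfg : ContDiffAt ℝ 2 (f - g) z := hf.sub hg
  have hfgψ : ContDiffAt ℝ 2 (f - g + ε • ψ) z := hfg.add hεψ
  have h := complexHessian_nonpos_of_isLocalMax hfgψ hmax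
  rw [complexHessian_add hfg hεψ, complexHessian_sub hf hg, complexHessian_const_smul hψ] at h
  rw [← sub_nonpos]
  convert h using 1
  rw [smul_neg]
  abel

/-! ### The norm of a holomorphic section -/

section Bundles

variable {n : ℕ} {X : Type*} [TopologicalSpace X] [ChartedSpace (Fin n → ℂ) X]
  {L : X → Type*} [∀ x, AddCommGroup (L x)] [∀ x, Module ℂ (L x)]
  [∀ x, TopologicalSpace (L x)] [TopologicalSpace (Bundle.TotalSpace ℂ L)]
  [FiberBundle ℂ L] [VectorBundle ℂ ℂ L]

theorem RealOneOneForm.continuousAt_coeff (a : RealOneOneForm n X)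
    {e : OpenPartialHomeomorph X (Fin n → ℂ)} (he : e ∈ atlas (Fin n → ℂ) X) {z : Fin n → ℂ}
    (hz : z ∈ e.target) : ContinuousAt (a.coeff e) z :=
  continuousAt_pi.2 fun i => continuousAt_pi.2 fun j =>
    ((a.smooth e he i j).contDiffAt (e.open_target.mem_nhds hz)).continuousAt

theorem SmoothOn.contDiffAt {f : X → ℝ} {W : Set X} (hf : SmoothOn n f W) (hW : IsOpen W)
    {e : OpenPartialHomeomorph X (Fin n → ℂ)} (he : e ∈ atlas (Fin n → ℂ) X) {z : Fin n → ℂ}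
    (hz : z ∈ e.target) (hzW : e.symm z ∈ W) : ContDiffAt ℝ ∞ (f ∘ e.symm) z :=
  (hf e he).contDiffAt ((e.isOpen_inter_preimage_symm hW).mem_nhds ⟨hz, hzW⟩)

theorem symm_one_ne_zero
    (τ : Bundle.Trivialization ℂ (Bundle.TotalSpace.proj : Bundle.TotalSpace ℂ L → X))
    [MemTrivializationAtlas τ] {x : X} (hx : x ∈ τ.baseSet) : τ.symm x (1 : ℂ) ≠ 0 := by
  intro h0
  have h1 : τ.linearMapAt ℂ x (τ.symm x (1 : ℂ)) = 1 := τ.linearMapAt_symm hx 1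
  rw [h0, map_zero] at h1
  exact zero_ne_one h1

namespace HermitianMetric

variable (h : HermitianMetric n L)

theorem normSq_zero (x : X) : h.normSq x 0 = 0 := by
  simpa using h.normSq_smul x 0 0

theorem normSq_eq
    (τ : Bundle.Trivialization ℂ (Bundle.TotalSpace.proj : Bundle.TotalSpace ℂ L → X))
    [MemTrivializationAtlas τ] {x : X} (hx : x ∈ τ.baseSet) (ξ : L x) :
    h.normSq x ξ = ‖(τ (Bundle.TotalSpace.mk' ℂ x ξ)).2‖ ^ 2 * h.normSq x (τ.symm x 1) := by
  have hcoord : τ.linearMapAt ℂ x ξ = (τ (Bundle.TotalSpace.mk' ℂ x ξ)).2 := by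
    rw [τ.coe_linearMapAt_of_mem hx]
  rw [← h.normSq_smul, ← hcoord, ← τ.symmₗ_apply (R := ℂ) hx, ← map_smul, smul_eq_mul, mul_one,
    τ.symmₗ_linearMapAt hx]

theorem contDiffAt_frame {e : OpenPartialHomeomorph X (Fin n → ℂ)}
    (he : e ∈ atlas (Fin n → ℂ) X)
    (τ : Bundle.Trivialization ℂ (Bundle.TotalSpace.proj : Bundle.TotalSpace ℂ L → X))
    [MemTrivializationAtlas τ] {z : Fin n → ℂ} (hz : z ∈ e.target) (hzτ : e.symm z ∈ τ.baseSet) :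
    ContDiffAt ℝ ∞ (fun w => h.normSq (e.symm w) (τ.symm (e.symm w) 1)) z :=
  (h.smooth e he τ).contDiffAt
    ((e.isOpen_inter_preimage_symm τ.open_baseSet).mem_nhds ⟨hz, hzτ⟩)

theorem contDiffAt_log_frame {e : OpenPartialHomeomorph X (Fin n → ℂ)}
    (he : e ∈ atlas (Fin n → ℂ) X)
    (τ : Bundle.Trivialization ℂ (Bundle.TotalSpace.proj : Bundle.TotalSpace ℂ L → X))
    [MemTrivializationAtlas τ] {z : Fin n → ℂ} (hz : z ∈ e.target) (hzτ : e.symm z ∈ τ.baseSet) :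
    ContDiffAt ℝ ∞ (fun w => Real.log (h.normSq (e.symm w) (τ.symm (e.symm w) 1))) z :=
  (h.contDiffAt_frame he τ hz hzτ).log (h.normSq_pos _ _ (symm_one_ne_zero τ hzτ)).ne'

/-- The function `|s|_h²` on `X`, for a section `s` of `L`. -/
def sectionNormSq (s : ∀ x, L x) (x : X) : ℝ :=
  h.normSq x (s x)

theorem sectionNormSq_pos {s : ∀ x, L x} {x : X} (hx : s x ≠ 0) : 0 < h.sectionNormSq s x :=
  h.normSq_pos x _ hx

theorem sectionNormSq_eq_zero {s : ∀ x, L x} {x : X} (hx : s x = 0) : h.sectionNormSq s x = 0 := by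
  rw [sectionNormSq, hx, h.normSq_zero]

end HermitianMetric

/-- `s` is a holomorphic section of `L`, i.e. complex analytic as a map into the total space. -/
def IsHolomorphicSection (n : ℕ) {X : Type*} [TopologicalSpace X] [ChartedSpace (Fin n → ℂ) X]
    {L : X → Type*} [∀ x, AddCommGroup (L x)] [∀ x, Module ℂ (L x)]
    [∀ x, TopologicalSpace (L x)] [TopologicalSpace (Bundle.TotalSpace ℂ L)]
    [FiberBundle ℂ L] [VectorBundle ℂ ℂ L] (s : ∀ x, L x) : Prop :=
  ContMDiff 𝓘(ℂ, Fin n → ℂ) (𝓘(ℂ, Fin n → ℂ).prod 𝓘(ℂ, ℂ)) ω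
    (fun x => (Bundle.TotalSpace.mk' ℂ x (s x) : Bundle.TotalSpace ℂ L))

namespace IsHolomorphicSection

variable [IsManifold 𝓘(ℂ, Fin n → ℂ) ω X] [ContMDiffVectorBundle ω ℂ L 𝓘(ℂ, Fin n → ℂ)]
  {s : ∀ x, L x} {e : OpenPartialHomeomorph X (Fin n → ℂ)} {z : Fin n → ℂ}

theorem contDiffAt_coeff (hs : IsHolomorphicSection n s) (he : e ∈ atlas (Fin n → ℂ) X)
    (τ : Bundle.Trivialization ℂ (Bundle.TotalSpace.proj : Bundle.TotalSpace ℂ L → X))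
    [MemTrivializationAtlas τ] (hz : z ∈ e.target) (hzτ : e.symm z ∈ τ.baseSet) :
    ContDiffAt ℂ ω (fun w => (τ (Bundle.TotalSpace.mk' ℂ (e.symm w) (s (e.symm w)))).2) z := by
  have hcoord := (τ.contMDiffOn_section_baseSet_iff (IB := 𝓘(ℂ, Fin n → ℂ)) (n := ω)).1
    (ContMDiff.contMDiffOn hs)
  have hsymm := contMDiffOn_symm_of_mem_maximalAtlas (I := 𝓘(ℂ, Fin n → ℂ)) (n := ω)
    (IsManifold.subset_maximalAtlas he)
  exact ((hcoord.contMDiffAt (τ.open_baseSet.mem_nhds hzτ)).comp z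
    (hsymm.contMDiffAt (e.open_target.mem_nhds hz))).contDiffAt

theorem contDiffAt_normSq (hs : IsHolomorphicSection n s) (h : HermitianMetric n L)
    (he : e ∈ atlas (Fin n → ℂ) X) (hz : z ∈ e.target) :
    ContDiffAt ℝ ∞ (h.sectionNormSq s ∘ e.symm) z := by
  set τ := trivializationAt ℂ L (e.symm z)
  have hzτ : e.symm z ∈ τ.baseSet := FiberBundle.mem_baseSet_trivializationAt' _
  have hcoeff := ((hs.contDiffAt_coeff he τ hz hzτ).restrict_scalars ℝ).of_le
    (le_top : (∞ : WithTop ℕ∞) ≤ ω)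
  refine ((hcoeff.norm_sq ℝ).mul (h.contDiffAt_frame he τ hz hzτ)).congr_of_eventuallyEq ?_
  filter_upwards [(e.isOpen_inter_preimage_symm τ.open_baseSet).mem_nhds ⟨hz, hzτ⟩] with w hw
  exact h.normSq_eq τ hw.2 _

theorem continuous_normSq (hs : IsHolomorphicSection n s) (h : HermitianMetric n L) :
    Continuous (h.sectionNormSq s) := by
  refine continuous_iff_continuousAt.2 fun p => ?_
  set e := chartAt (Fin n → ℂ) p
  have hp : p ∈ e.source := mem_chart_source _ p
  have hchart : ContinuousAt (h.sectionNormSq s ∘ e.symm) (e p) :=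
    (hs.contDiffAt_normSq h (chart_mem_atlas _ p) (e.map_source hp)).continuousAt
  refine (hchart.comp (e.continuousAt hp)).congr ?_
  filter_upwards [e.open_source.mem_nhds hp] with x hx
  exact congrArg (h.sectionNormSq s) (e.left_inv hx)

theorem contDiffAt_log_normSq (hs : IsHolomorphicSection n s) (h : HermitianMetric n L)
    (he : e ∈ atlas (Fin n → ℂ) X) (hz : z ∈ e.target) (hsz : s (e.symm z) ≠ 0) :
    ContDiffAt ℝ ∞ (fun w => Real.log (h.sectionNormSq s (e.symm w))) z :=
  (hs.contDiffAt_normSq h he hz).log (h.sectionNormSq_pos hsz).ne'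

theorem contDiffAt_normSq_rpow (hs : IsHolomorphicSection n s) (h : HermitianMetric n L)
    (he : e ∈ atlas (Fin n → ℂ) X) (hz : z ∈ e.target) (hsz : s (e.symm z) ≠ 0) (γ : ℝ) :
    ContDiffAt ℝ ∞ (fun w => h.sectionNormSq s (e.symm w) ^ γ) z :=
  (hs.contDiffAt_normSq h he hz).rpow_const_of_ne (h.sectionNormSq_pos hsz).ne'

theorem complexHessian_log_normSq (hs : IsHolomorphicSection n s) (h : HermitianMetric n L)
    (he : e ∈ atlas (Fin n → ℂ) X)
    (τ : Bundle.Trivialization ℂ (Bundle.TotalSpace.proj : Bundle.TotalSpace ℂ L → X))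
    [MemTrivializationAtlas τ] (hz : z ∈ e.target) (hzτ : e.symm z ∈ τ.baseSet)
    (hsz : s (e.symm z) ≠ 0) :
    complexHessian (fun w => Real.log (h.sectionNormSq s (e.symm w))) z =
      complexHessian (fun w => Real.log (h.normSq (e.symm w) (τ.symm (e.symm w) 1))) z := by
  have hc := (hs.contDiffAt_coeff he τ hz hzτ).of_le (le_top : (2 : WithTop ℕ∞) ≤ ω)
  have hc0 : (τ (Bundle.TotalSpace.mk' ℂ (e.symm z) (s (e.symm z)))).2 ≠ 0 := fun h0 =>
    (h.sectionNormSq_pos hsz).ne' (by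
      rw [HermitianMetric.sectionNormSq, h.normSq_eq τ hzτ, h0, norm_zero, zero_pow two_ne_zero,
        zero_mul])
  have hlogc := ((hc.restrict_scalars ℝ).norm_sq ℝ).log (pow_ne_zero 2 (norm_ne_zero_iff.2 hc0))
  have hsplit : (fun w => Real.log (h.sectionNormSq s (e.symm w))) =ᶠ[𝓝 z]
      (fun w => Real.log (‖(τ (Bundle.TotalSpace.mk' ℂ (e.symm w) (s (e.symm w)))).2‖ ^ 2)) +
        fun w => Real.log (h.normSq (e.symm w) (τ.symm (e.symm w) 1)) := by
    filter_upwards [(e.isOpen_inter_preimage_symm τ.open_baseSet).mem_nhds ⟨hz, hzτ⟩,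
      hc.continuousAt.eventually_ne hc0] with w hw hw0
    rw [HermitianMetric.sectionNormSq, h.normSq_eq τ hw.2,
      Real.log_mul (pow_ne_zero 2 (norm_ne_zero_iff.2 hw0))
        (h.normSq_pos _ _ (symm_one_ne_zero τ hw.2)).ne', Pi.add_apply]
  rw [complexHessian_congr hsplit,
    complexHessian_add hlogc ((h.contDiffAt_log_frame he τ hz hzτ).of_le ENat.LEInfty.out),
    complexHessian_log_norm_sq_eq_zero hc hc0, zero_add]

theorem exists_neg_complexHessian_log_normSq_le [CompactSpace X]
    (hs : IsHolomorphicSection n s) (h : HermitianMetric n L) {a : RealOneOneForm n X}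
    (ha : ∀ e ∈ atlas (Fin n → ℂ) X, ∀ z ∈ e.target, (a.coeff e z).PosDef) :
    ∃ C : ℝ, 0 ≤ C ∧ ∀ x, s x ≠ 0 → ∃ e ∈ atlas (Fin n → ℂ) X, x ∈ e.source ∧
      -complexHessian (fun w => Real.log (h.sectionNormSq s (e.symm w))) (e x) ≤
        C • a.coeff e (e x) := by
  suffices ∃ C : {C : ℝ // 0 ≤ C}, ∀ x, s x ≠ 0 → ∃ e ∈ atlas (Fin n → ℂ) X, x ∈ e.source ∧
      -complexHessian (fun w => Real.log (h.sectionNormSq s (e.symm w))) (e x) ≤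
        (C : ℝ) • a.coeff e (e x) from this.elim fun C hC => ⟨C, C.2, hC⟩
  refine exists_forall_of_eventually (fun x C C' hCC' hx hsx => ?_) fun p => ?_
  · obtain ⟨e, he, hxe, hle⟩ := hx hsx
    exact ⟨e, he, hxe, hle.trans (smul_le_smul_of_nonneg_right hCC'
      (ha e he _ (e.map_source hxe)).posSemidef.nonneg)⟩
  · set e := chartAt (Fin n → ℂ) p
    set τ := trivializationAt ℂ L p
    have he : e ∈ atlas (Fin n → ℂ) X := chart_mem_atlas _ p
    have hp : p ∈ e.source := mem_chart_source _ p
    have hpτ : p ∈ τ.baseSet := FiberBundle.mem_baseSet_trivializationAt' p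
    have hlog : ContDiffAt ℝ 2
        (fun w => Real.log (h.normSq (e.symm w) (τ.symm (e.symm w) 1))) (e p) :=
      (h.contDiffAt_log_frame he τ (e.map_source hp) (by rwa [e.left_inv hp])).of_le
        ENat.LEInfty.out
    obtain ⟨C, hC, hbound⟩ := eventually_le_smul_of_posDef
      (a.continuousAt_coeff he (e.map_source hp)) (continuousAt_complexHessian hlog).neg
      (eventually_of_mem (e.open_target.mem_nhds (e.map_source hp)) (ha e he))
      ((hlog.eventually (by simp)).mono fun w hw => (isHermitian_complexHessian hw).neg)
    refine ⟨⟨C, hC⟩, ?_⟩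
    filter_upwards [e.open_source.mem_nhds hp, τ.open_baseSet.mem_nhds hpτ,
      (e.continuousAt hp).eventually hbound] with x hx hxτ hle hsx
    refine ⟨e, he, hx, ?_⟩
    rwa [hs.complexHessian_log_normSq h he τ (e.map_source hx) (by rwa [e.left_inv hx])
      (by rwa [e.left_inv hx])]

end IsHolomorphicSection

end Bundles

/-! ### The barrier function -/

section Barrier

theorem tendsto_log_sub_mul_rpow_nhdsGT_zero {γ : ℝ} (hγ : 0 < γ) (c : ℝ) :
    Tendsto (fun r => Real.log r - c * r ^ γ) (𝓝[>] 0) atBot := by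
  have hrpow : Tendsto (fun r : ℝ => -(c * r ^ γ)) (𝓝[>] 0) (𝓝 0) := by
    refine Tendsto.mono_left (Continuous.tendsto' ?_ _ _ ?_) nhdsWithin_le_nhds
    · exact (continuous_const.mul (Real.continuous_rpow_const hγ.le)).neg
    · rw [Real.zero_rpow hγ.ne', mul_zero, neg_zero]
  simpa only [sub_eq_add_neg] using Real.tendsto_log_nhdsGT_zero.atBot_add hrpow

variable {n : ℕ} {X : Type*} [TopologicalSpace X] [ChartedSpace (Fin n → ℂ) X]
  {L : X → Type*} [∀ x, AddCommGroup (L x)] [∀ x, Module ℂ (L x)]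
  [∀ x, TopologicalSpace (L x)] [TopologicalSpace (Bundle.TotalSpace ℂ L)]
  [FiberBundle ℂ L] [VectorBundle ℂ ℂ L]

/-- The barrier function `log |s|_h² - c |s|_h^{2γ}` of the maximum principle on the complement of
the divisor: it tends to `-∞` along the zeros of `s`, and with `c = k C` its complex Hessian is
bounded below by `-C ω_γ`. -/
noncomputable def barrier (h : HermitianMetric n L) (s : ∀ x, L x) (γ c : ℝ) (x : X) : ℝ :=
  Real.log (h.sectionNormSq s x) - c * h.sectionNormSq s x ^ γ

namespace IsHolomorphicSection

variable [IsManifold 𝓘(ℂ, Fin n → ℂ) ω X] [ContMDiffVectorBundle ω ℂ L 𝓘(ℂ, Fin n → ℂ)]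
  {s : ∀ x, L x} {D : Set X} {e : OpenPartialHomeomorph X (Fin n → ℂ)} {z : Fin n → ℂ} {γ : ℝ}

theorem continuous_barrier (hs : IsHolomorphicSection n s) (hD : ∀ x, x ∈ D ↔ s x = 0)
    (h : HermitianMetric n L) (hγ : 0 < γ) (c : ℝ) :
    Continuous fun x : ↥Dᶜ => barrier h s γ c x := by
  have hcont : Continuous fun x : ↥Dᶜ => h.sectionNormSq s x :=
    (hs.continuous_normSq h).comp continuous_subtype_val
  exact (hcont.log fun x => (h.sectionNormSq_pos (mt (hD x).2 x.2)).ne').sub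
    (continuous_const.mul (hcont.rpow_const fun _ => .inr hγ.le))

theorem tendsto_barrier_cocompact [CompactSpace X] (hs : IsHolomorphicSection n s)
    (hD : ∀ x, x ∈ D ↔ s x = 0) (h : HermitianMetric n L) (hγ : 0 < γ) (c : ℝ) :
    Tendsto (fun x : ↥Dᶜ => barrier h s γ c x) (cocompact ↥Dᶜ) atBot := by
  have hzero : Tendsto (fun x : ↥Dᶜ => h.sectionNormSq s x) (cocompact ↥Dᶜ) (𝓝 0) :=
    tendsto_cocompact_subtype (hs.continuous_normSq h)
      fun x hx => h.sectionNormSq_eq_zero ((hD x).1 (not_not.1 hx))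
  exact (tendsto_log_sub_mul_rpow_nhdsGT_zero hγ c).comp
    (tendsto_nhdsWithin_of_tendsto_nhds_of_eventually_within _ hzero
      (.of_forall fun x => h.sectionNormSq_pos (mt (hD x).2 x.2)))

theorem contDiffAt_barrier (hs : IsHolomorphicSection n s) (h : HermitianMetric n L)
    (he : e ∈ atlas (Fin n → ℂ) X) (hz : z ∈ e.target) (hsz : s (e.symm z) ≠ 0) (γ c : ℝ) :
    ContDiffAt ℝ ∞ (barrier h s γ c ∘ e.symm) z :=
  (hs.contDiffAt_log_normSq h he hz hsz).sub
    (contDiffAt_const.mul (hs.contDiffAt_normSq_rpow h he hz hsz γ))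

theorem complexHessian_barrier (hs : IsHolomorphicSection n s) (h : HermitianMetric n L)
    (he : e ∈ atlas (Fin n → ℂ) X) (hz : z ∈ e.target) (hsz : s (e.symm z) ≠ 0) (γ c : ℝ) :
    complexHessian (barrier h s γ c ∘ e.symm) z =
      complexHessian (fun w => Real.log (h.sectionNormSq s (e.symm w))) z -
        c • complexHessian (fun w => h.sectionNormSq s (e.symm w) ^ γ) z := by
  have hrpow : ContDiffAt ℝ 2 (fun w => h.sectionNormSq s (e.symm w) ^ γ) z :=
    (hs.contDiffAt_normSq_rpow h he hz hsz γ).of_le ENat.LEInfty.out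
  have hcrpow : ContDiffAt ℝ 2 (c • fun w => h.sectionNormSq s (e.symm w) ^ γ) z :=
    contDiffAt_const.smul hrpow
  rw [← complexHessian_const_smul hrpow, ← complexHessian_sub
    ((hs.contDiffAt_log_normSq h he hz hsz).of_le ENat.LEInfty.out) hcrpow]
  rfl

theorem exists_neg_complexHessian_barrier_le [CompactSpace X] (hs : IsHolomorphicSection n s)
    (h : HermitianMetric n L) {ωK : RealOneOneForm n X}
    (hωK : ∀ e ∈ atlas (Fin n → ℂ) X, ∀ z ∈ e.target, (ωK.coeff e z).PosDef) (γ k : ℝ) :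
    ∃ C : ℝ, 0 ≤ C ∧ ∀ x, s x ≠ 0 → ∃ e ∈ atlas (Fin n → ℂ) X, x ∈ e.source ∧
      -complexHessian (barrier h s γ (k * C) ∘ e.symm) (e x) ≤
        C • conicalForm ωK h s γ k e (e x) := by
  obtain ⟨C, hC, hcurv⟩ := hs.exists_neg_complexHessian_log_normSq_le h hωK
  refine ⟨C, hC, fun x hx => ?_⟩
  obtain ⟨e, he, hxe, hle⟩ := hcurv x hx
  refine ⟨e, he, hxe, ?_⟩
  rw [hs.complexHessian_barrier h he (e.map_source hxe) (by rwa [e.left_inv hxe]), neg_sub,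
    sub_eq_neg_add, conicalForm, Complex.coe_smul, smul_add, smul_smul, mul_comm C k]
  exact add_le_add_left hle _

end IsHolomorphicSection

namespace IsDefiningSection

variable {s : ∀ x, L x} {D : Set X}

theorem isHolomorphicSection (hs : IsDefiningSection n s D) : IsHolomorphicSection n s := hs.1

theorem mem_iff (hs : IsDefiningSection n s D) (x : X) : x ∈ D ↔ s x = 0 := hs.2.1 x

theorem isOpen_compl [IsManifold 𝓘(ℂ, Fin n → ℂ) ω X]
    [ContMDiffVectorBundle ω ℂ L 𝓘(ℂ, Fin n → ℂ)] (hs : IsDefiningSection n s D)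
    (h : HermitianMetric n L) : IsOpen Dᶜ := by
  have hD : D = h.sectionNormSq s ⁻¹' {0} := by
    ext x
    rw [hs.mem_iff]
    exact ⟨h.sectionNormSq_eq_zero, fun hx => by_contra fun h0 => (h.sectionNormSq_pos h0).ne' hx⟩
  rw [hD, isOpen_compl_iff]
  exact isClosed_singleton.preimage (hs.isHolomorphicSection.continuous_normSq h)

theorem dense_compl (hs : IsDefiningSection n s D) : Dense Dᶜ := by
  refine interior_eq_empty_iff_dense_compl.1 (eq_empty_iff_forall_notMem.2 fun p hp => ?_)
  set e := chartAt (Fin n → ℂ) p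
  set τ := trivializationAt ℂ L p
  have hsymm : Tendsto e.symm (𝓝 (e p)) (𝓝 p) := e.tendsto_symm (mem_chart_source _ p)
  have hvanish : (fun z => (τ (Bundle.TotalSpace.mk' ℂ (e.symm z) (s (e.symm z)))).2)
      =ᶠ[𝓝 (e p)] fun _ => 0 := by
    filter_upwards [hsymm.eventually (mem_interior_iff_mem_nhds.1 hp), hsymm.eventually
      (τ.open_baseSet.mem_nhds (FiberBundle.mem_baseSet_trivializationAt' p))] with z hzD hzτ
    rw [(hs.mem_iff _).1 hzD]
    exact congrArg Prod.snd (τ.zeroSection ℂ hzτ)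
  refine hs.2.2 p (interior_subset hp) ?_
  rw [hvanish.fderiv_eq, fderiv_const_apply]

end IsDefiningSection

end Barrier

/-! ### Comparison of sub- and supersolutions -/

section Comparison

theorem posDef_of_le_smul {m : Type*} {A B : Matrix m m ℂ} {c : ℝ}
    (hA : A.PosDef) (hc : 0 < c) (h : A ≤ c • B) : B.PosDef := by
  have hcB : (c • B).PosDef := by simpa using hA.add_posSemidef h
  simpa [smul_smul, hc.ne'] using hcB.smul (inv_pos.2 hc)

variable {n : ℕ} {X : Type*} [TopologicalSpace X] [ChartedSpace (Fin n → ℂ) X]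
  {L : X → Type*} [∀ x, AddCommGroup (L x)] [∀ x, Module ℂ (L x)]
  [∀ x, TopologicalSpace (L x)] [TopologicalSpace (Bundle.TotalSpace ℂ L)]
  [FiberBundle ℂ L] [VectorBundle ℂ ℂ L]
  {ωK η : RealOneOneForm n X} {D : Set X} {h : HermitianMetric n L} {s : ∀ x, L x}
  {hγ : X → ℝ} {α γ k T : ℝ} {u₀ v₀ : X → ℝ} {u v : ℝ → X → ℝ}

theorem IsAdmissible.exists_conicalForm_equivalence
    (hu : IsAdmissible ωK η D h s hγ α γ k T u₀ u) {a b : ℝ} (ha : 0 < a) (hab : a ≤ b)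
    (hbT : b < T) :
    ∃ C : ℝ, 0 < C ∧ ∀ t ∈ Icc a b, ∀ e ∈ atlas (Fin n → ℂ) X, ∀ z ∈ e.target, e.symm z ∉ D →
      conicalForm ωK h s γ k e z ≤ C • potentialForm ωK η h hγ γ t (u t) e z ∧
        potentialForm ωK η h hγ γ t (u t) e z ≤ C • conicalForm ωK h s γ k e z := by
  obtain ⟨C, hC, hequiv⟩ := hu.equivalent (a / 2) ((b + T) / 2) (by linarith) (by linarith)
    (by linarith)
  refine ⟨C, hC, fun t ht e he z hz hzD => ?_⟩
  obtain ⟨hlower, hupper⟩ :=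
    hequiv t ⟨by linarith [ht.1], by linarith [ht.2]⟩ e he z hz hzD
  rw [← Matrix.le_iff, Complex.coe_smul] at hlower hupper
  exact ⟨(inv_smul_le_iff_of_pos hC).1 hlower, hupper⟩

theorem potentialForm_le_of_isMax [IsManifold 𝓘(ℂ, Fin n → ℂ) ω X]
    [ContMDiffVectorBundle ω ℂ L 𝓘(ℂ, Fin n → ℂ)] (hs : IsDefiningSection n s D)
    {f g : X → ℝ} (hf : SmoothOn n f Dᶜ) (hg : SmoothOn n g Dᶜ)
    {e : OpenPartialHomeomorph X (Fin n → ℂ)} (he : e ∈ atlas (Fin n → ℂ) X) {x : X}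
    (hx : x ∈ e.source) (hxD : x ∉ D) {c t ε : ℝ}
    (hmax : ∀ y ∉ D, f y - g y + ε * barrier h s γ c y ≤ f x - g x + ε * barrier h s γ c x) :
    potentialForm ωK η h hγ γ t f e (e x) ≤ potentialForm ωK η h hγ γ t g e (e x) +
      ε • -complexHessian (barrier h s γ c ∘ e.symm) (e x) := by
  have hz := e.map_source hx
  have hzD : e.symm (e x) ∈ Dᶜ := by rwa [e.left_inv hx]
  have hopen := hs.isOpen_compl h
  have hloc : IsLocalMax (f ∘ e.symm - g ∘ e.symm + ε • (barrier h s γ c ∘ e.symm)) (e x) := by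
    filter_upwards [(e.isOpen_inter_preimage_symm hopen).mem_nhds ⟨hz, hzD⟩] with w hw
    simpa [e.left_inv hx] using hmax _ hw.2
  have hbarrier := hs.isHolomorphicSection.contDiffAt_barrier h he hz
    (mt (hs.mem_iff _).2 hzD) γ c
  have hHess := complexHessian_le_add_of_isLocalMax
    ((hf.contDiffAt hopen he hz hzD).of_le ENat.LEInfty.out)
    ((hg.contDiffAt hopen he hz hzD).of_le ENat.LEInfty.out)
    (hbarrier.of_le ENat.LEInfty.out) hloc
  rw [potentialForm, potentialForm, add_assoc]
  exact add_le_add_right hHess _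

theorem IsAdmissible.posDef_potentialForm (hu : IsAdmissible ωK η D h s hγ α γ k T u₀ u)
    (hcone : ∀ e ∈ atlas (Fin n → ℂ) X, ∀ z ∈ e.target, e.symm z ∉ D →
      (conicalForm ωK h s γ k e z).PosDef)
    {t : ℝ} (ht : t ∈ Ioo 0 T) {e : OpenPartialHomeomorph X (Fin n → ℂ)}
    (he : e ∈ atlas (Fin n → ℂ) X) {z : Fin n → ℂ} (hz : z ∈ e.target) (hzD : e.symm z ∉ D) :
    (potentialForm ωK η h hγ γ t (u t) e z).PosDef := by
  obtain ⟨C, hC, hequiv⟩ := hu.exists_conicalForm_equivalence ht.1 le_rfl ht.2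
  exact posDef_of_le_smul (hcone e he z hz hzD) hC
    (hequiv t (left_mem_Icc.2 le_rfl) e he z hz hzD).1

theorem deriv_sub_le_of_potentialForm_le_smul
    (hωK : ∀ e ∈ atlas (Fin n → ℂ) X, ∀ z ∈ e.target, (ωK.coeff e z).PosDef)
    (hcone : ∀ e ∈ atlas (Fin n → ℂ) X, ∀ z ∈ e.target, e.symm z ∉ D →
      (conicalForm ωK h s γ k e z).PosDef)
    (hu : IsSubsolution ωK η D h s hγ α γ k T u₀ u)
    (hv : IsSupersolution ωK η D h s hγ α γ k T v₀ v) {t : ℝ} (ht : t ∈ Ioo 0 T)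
    {e : OpenPartialHomeomorph X (Fin n → ℂ)} (he : e ∈ atlas (Fin n → ℂ) X) {x : X}
    (hx : x ∈ e.source) (hxD : x ∉ D) {c : ℝ} (hc : 0 < c)
    (hle : potentialForm ωK η h hγ γ t (u t) e (e x) ≤
      c • potentialForm ωK η h hγ γ t (v t) e (e x)) :
    deriv (fun τ => u τ x - v τ x) t ≤ n * Real.log c := by
  have hz := e.map_source hx
  have hzD : e.symm (e x) ∉ D := by rwa [e.left_inv hx]
  have hω := det_re_pos (hωK e he _ hz)
  have hU := hu.1.posDef_potentialForm hcone ht he hz hzD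
  have hV := hv.1.posDef_potentialForm hcone ht he hz hzD
  have hsub := hu.2 t ht e he _ hz hzD
  have hsuper := hv.2 t ht e he _ hz hzD
  have hlogdet := log_det_le_of_le_smul hU hV hc hle
  simp only [mongeAmpereRHS, e.left_inv hx] at hsub hsuper
  rw [Real.log_div (det_re_pos hU).ne' hω.ne'] at hsub
  rw [Real.log_div (det_re_pos hV).ne' hω.ne'] at hsuper
  rw [Fintype.card_fin] at hlogdet
  rw [deriv_fun_sub (hu.1.time_diff t ht x hxD) (hv.1.time_diff t ht x hxD)]
  linarith

theorem exists_deriv_sub_le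
    (hωK : ∀ e ∈ atlas (Fin n → ℂ) X, ∀ z ∈ e.target, (ωK.coeff e z).PosDef)
    (hcone : ∀ e ∈ atlas (Fin n → ℂ) X, ∀ z ∈ e.target, e.symm z ∉ D →
      (conicalForm ωK h s γ k e z).PosDef)
    (hu : IsSubsolution ωK η D h s hγ α γ k T u₀ u)
    (hv : IsSupersolution ωK η D h s hγ α γ k T v₀ v) {a b : ℝ} (ha : 0 < a) (hab : a ≤ b)
    (hbT : b < T) :
    ∃ K, ∀ t ∈ Icc a b, ∀ x ∉ D, deriv (fun τ => u τ x - v τ x) t ≤ K := by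
  obtain ⟨C₁, hC₁, hequivU⟩ := hu.1.exists_conicalForm_equivalence ha hab hbT
  obtain ⟨C₂, hC₂, hequivV⟩ := hv.1.exists_conicalForm_equivalence ha hab hbT
  refine ⟨n * Real.log (C₁ * C₂), fun t ht x hx => ?_⟩
  set e := chartAt (Fin n → ℂ) x
  have he : e ∈ atlas (Fin n → ℂ) X := chart_mem_atlas _ x
  have hxe : x ∈ e.source := mem_chart_source _ x
  have hxD : e.symm (e x) ∉ D := by rwa [e.left_inv hxe]
  refine deriv_sub_le_of_potentialForm_le_smul hωK hcone hu hv (Icc_subset_Ioo ha hbT ht) he hxe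
    hx (mul_pos hC₁ hC₂) ?_
  calc potentialForm ωK η h hγ γ t (u t) e (e x)
      ≤ C₁ • conicalForm ωK h s γ k e (e x) :=
        (hequivU t ht e he _ (e.map_source hxe) hxD).2
    _ ≤ C₁ • C₂ • potentialForm ωK η h hγ γ t (v t) e (e x) :=
        smul_le_smul_of_nonneg_left (hequivV t ht e he _ (e.map_source hxe) hxD).1 hC₁.le
    _ = (C₁ * C₂) • potentialForm ωK η h hγ γ t (v t) e (e x) := smul_smul _ _ _

theorem eventually_sub_le_of_initial [CompactSpace X]
    (hu : IsAdmissible ωK η D h s hγ α γ k T u₀ u)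
    (hv : IsAdmissible ωK η D h s hγ α γ k T v₀ v) {ε : ℝ} (hε : 0 < ε) :
    ∀ᶠ t in 𝓝[>] 0, ∀ x, u t x - v t x ≤ (⨆ y, (u₀ y - v₀ y)) + ε := by
  have hcont : Continuous fun y => u₀ y - v₀ y := hu.initial_psh.1.sub hv.initial_psh.1
  filter_upwards [Metric.tendstoUniformly_iff.1 (hu.initial.sub hv.initial) ε hε] with t ht x
  have hclose := abs_lt.1 (ht x)
  have hsup := le_ciSup (isCompact_range hcont).bddAbove x
  simp only [Pi.sub_apply] at hclose
  linarith [hclose.1]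

variable [CompactSpace X] [IsManifold 𝓘(ℂ, Fin n → ℂ) ω X]
  [ContMDiffVectorBundle ω ℂ L 𝓘(ℂ, Fin n → ℂ)]

theorem exists_barrier_deriv_sub_le_of_isMax (hs : IsDefiningSection n s D)
    (hωK : ∀ e ∈ atlas (Fin n → ℂ) X, ∀ z ∈ e.target, (ωK.coeff e z).PosDef)
    (hcone : ∀ e ∈ atlas (Fin n → ℂ) X, ∀ z ∈ e.target, e.symm z ∉ D →
      (conicalForm ωK h s γ k e z).PosDef)
    (hu : IsSubsolution ωK η D h s hγ α γ k T u₀ u)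
    (hv : IsSupersolution ωK η D h s hγ α γ k T v₀ v) {a b : ℝ} (ha : 0 < a) (hab : a ≤ b)
    (hbT : b < T) :
    ∃ c A, ∀ t ∈ Icc a b, ∀ ε > 0, ∀ x ∉ D,
      (∀ y ∉ D, u t y - v t y + ε * barrier h s γ c y ≤
        u t x - v t x + ε * barrier h s γ c x) →
      deriv (fun τ => u τ x - v τ x) t ≤ ε * A := by
  obtain ⟨B, hB, hbarrier⟩ :=
    hs.isHolomorphicSection.exists_neg_complexHessian_barrier_le h hωK γ k
  obtain ⟨C, hC, hequivV⟩ := hv.1.exists_conicalForm_equivalence ha hab hbT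
  refine ⟨k * B, n * (B * C), fun t ht ε hε x hx hmax => ?_⟩
  have htT : t ∈ Ioo 0 T := Icc_subset_Ioo ha hbT ht
  obtain ⟨e, he, hxe, hHess⟩ := hbarrier x (mt (hs.mem_iff x).2 hx)
  have hxD : e.symm (e x) ∉ D := by rwa [e.left_inv hxe]
  set V := potentialForm ωK η h hγ γ t (v t) e (e x)
  have hconeV : -complexHessian (barrier h s γ (k * B) ∘ e.symm) (e x) ≤ (B * C) • V := by
    rw [← smul_smul]
    exact hHess.trans (smul_le_smul_of_nonneg_left
      (hequivV t ht e he _ (e.map_source hxe) hxD).1 hB)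
  have hUV : potentialForm ωK η h hγ γ t (u t) e (e x) ≤ (1 + ε * (B * C)) • V :=
    calc potentialForm ωK η h hγ γ t (u t) e (e x)
        ≤ V + ε • -complexHessian (barrier h s γ (k * B) ∘ e.symm) (e x) :=
          potentialForm_le_of_isMax hs (hu.1.regular t htT).2 (hv.1.regular t htT).2 he hxe hx
            hmax
      _ ≤ V + ε • (B * C) • V := add_le_add_right (smul_le_smul_of_nonneg_left hconeV hε.le) V
      _ = (1 + ε * (B * C)) • V := by rw [add_smul, one_smul, smul_smul]
  have hpos : 0 < 1 + ε * (B * C) := by positivity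
  calc deriv (fun τ => u τ x - v τ x) t
      ≤ n * Real.log (1 + ε * (B * C)) :=
        deriv_sub_le_of_potentialForm_le_smul hωK hcone hu hv htT he hxe hx hpos hUV
    _ ≤ n * (ε * (B * C)) := by
        gcongr
        linarith [Real.log_le_sub_one_of_pos hpos]
    _ = ε * (n * (B * C)) := by ring

theorem sub_le_of_sub_le_of_le (hs : IsDefiningSection n s D)
    (hωK : ∀ e ∈ atlas (Fin n → ℂ) X, ∀ z ∈ e.target, (ωK.coeff e z).PosDef) (hγ0 : 0 < γ)
    (hcone : ∀ e ∈ atlas (Fin n → ℂ) X, ∀ z ∈ e.target, e.symm z ∉ D →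
      (conicalForm ωK h s γ k e z).PosDef)
    (hu : IsSubsolution ωK η D h s hγ α γ k T u₀ u)
    (hv : IsSupersolution ωK η D h s hγ α γ k T v₀ v) {a b M : ℝ} (ha : 0 < a) (hab : a ≤ b)
    (hbT : b < T) (hM : ∀ x ∉ D, u a x - v a x ≤ M) {x : X} (hx : x ∉ D) :
    u b x - v b x ≤ M := by
  have hT : ∀ t ∈ Icc a b, t ∈ Ioo 0 T := fun t ht => Icc_subset_Ioo ha hbT ht
  have hcont : ∀ t ∈ Icc a b, Continuous fun x => u t x - v t x := fun t ht =>
    (hu.1.regular t (hT t ht)).1.1.sub (hv.1.regular t (hT t ht)).1.1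
  obtain ⟨K, hK⟩ := exists_deriv_sub_le hωK hcone hu hv ha hab hbT
  obtain ⟨c, A, hmax⟩ := exists_barrier_deriv_sub_le_of_isMax hs hωK hcone hu hv ha hab hbT
  exact le_of_deriv_le_mul_of_isMax (w := fun t (x : ↥Dᶜ) => u t x - v t x) hab
    (hs.isHolomorphicSection.continuous_barrier hs.mem_iff h hγ0 c)
    (hs.isHolomorphicSection.tendsto_barrier_cocompact hs.mem_iff h hγ0 c)
    (fun t ht => (hcont t ht).comp continuous_subtype_val)
    (fun t ht => (isCompact_range (hcont t ht)).bddAbove.mono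
      (range_comp_subset_range Subtype.val fun x => u t x - v t x))
    (fun t ht x => (hu.1.time_diff t (hT t ht) x x.2).sub (hv.1.time_diff t (hT t ht) x x.2))
    (fun t ht x => hK t ht x x.2)
    (fun t ht ε hε x hmax' => hmax t ht ε hε x x.2 fun y hy => hmax' ⟨y, hy⟩)
    (fun x => hM x x.2) ⟨x, hx⟩

end Comparison

end ConicalFlow

theorem proposition0313003_general
    {n : ℕ} {X : Type*} [TopologicalSpace X] [CompactSpace X]
    [ChartedSpace (Fin n → ℂ) X] [IsManifold 𝓘(ℂ, Fin n → ℂ) ω X]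
    {L : X → Type*} [∀ x, AddCommGroup (L x)] [∀ x, Module ℂ (L x)]
    [∀ x, TopologicalSpace (L x)] [TopologicalSpace (Bundle.TotalSpace ℂ L)]
    [FiberBundle ℂ L] [VectorBundle ℂ ℂ L]
    [ContMDiffVectorBundle ω ℂ L 𝓘(ℂ, Fin n → ℂ)]
    {ωK η : ConicalFlow.RealOneOneForm n X}
    (hωK : ∀ e ∈ atlas (Fin n → ℂ) X, ∀ z ∈ e.target, (ωK.coeff e z).PosDef)
    {D : Set X} {h : ConicalFlow.HermitianMetric n L} {s : ∀ x, L x}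
    (hs : ConicalFlow.IsDefiningSection n s D) {α γ k T : ℝ} (hγ0 : 0 < γ)
    (hcone : ∀ e ∈ atlas (Fin n → ℂ) X, ∀ z ∈ e.target, e.symm z ∉ D →
      (ConicalFlow.conicalForm ωK h s γ k e z).PosDef)
    {hγ u₀ v₀ : X → ℝ} {u v : ℝ → X → ℝ}
    (hu : ConicalFlow.IsSubsolution ωK η D h s hγ α γ k T u₀ u)
    (hv : ConicalFlow.IsSupersolution ωK η D h s hγ α γ k T v₀ v) :
    ∀ t ∈ Set.Ioo 0 T, ∀ x : X, u t x - v t x ≤ ⨆ y : X, (u₀ y - v₀ y) := by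
  intro t ht
  have hoff : ∀ x ∈ Dᶜ, u t x - v t x ≤ ⨆ y, (u₀ y - v₀ y) := fun x hx => by
    refine le_of_forall_pos_le_add fun ε hε => ?_
    obtain ⟨t₀, hinitial, ht₀⟩ := ((ConicalFlow.eventually_sub_le_of_initial hu.1 hv.1 hε).and
      (Ioo_mem_nhdsGT ht.1)).exists
    exact ConicalFlow.sub_le_of_sub_le_of_le hs hωK hγ0 hcone hu hv ht₀.1 ht₀.2.le ht.2
      (fun y _ => hinitial y) hx
  have hclosed : IsClosed {x | u t x - v t x ≤ ⨆ y, (u₀ y - v₀ y)} :=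
    isClosed_le ((hu.1.regular t ht).1.1.sub (hv.1.regular t ht).1.1) continuous_const
  exact fun x => hclosed.closure_subset_iff.2 hoff (hs.dense_compl x)

theorem proposition0313003
    {n : ℕ} {X : Type*} [TopologicalSpace X] [T2Space X] [CompactSpace X]
    [ChartedSpace (Fin n → ℂ) X] [IsManifold 𝓘(ℂ, Fin n → ℂ) ω X]
    {L : X → Type*} [∀ x, AddCommGroup (L x)] [∀ x, Module ℂ (L x)]
    [∀ x, TopologicalSpace (L x)] [TopologicalSpace (Bundle.TotalSpace ℂ L)]
    [FiberBundle ℂ L] [VectorBundle ℂ ℂ L]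
    [ContMDiffVectorBundle ω ℂ L 𝓘(ℂ, Fin n → ℂ)]
    (ωK η : ConicalFlow.RealOneOneForm n X) (hωK : ωK.IsKahler) (hη : η.IsClosed)
    (D : Set X) (h : ConicalFlow.HermitianMetric n L) (s : ∀ x, L x)
    (hs : ConicalFlow.IsDefiningSection n s D)
    (α γ k T : ℝ) (hα : 0 < α ∧ α < 1) (hγ01 : 0 < γ ∧ γ ≤ 1) (hT : 0 < T)
    (hk : 0 < k)
    (hcone : ∀ e ∈ atlas (Fin n → ℂ) X, ∀ z ∈ e.target, e.symm z ∉ D →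
      (ConicalFlow.conicalForm ωK h s γ k e z).PosDef)
    (hγ : X → ℝ) (hγ_smooth : ConicalFlow.SmoothOn n hγ Set.univ)
    (hbackground : ∀ t ∈ Set.Icc 0 T, ∀ e ∈ atlas (Fin n → ℂ) X, ∀ z ∈ e.target,
      (ConicalFlow.backgroundForm ωK η h hγ γ t e z).PosDef)
    (u₀ v₀ : X → ℝ) (u v : ℝ → X → ℝ)
    (hu : ConicalFlow.IsSubsolution ωK η D h s hγ α γ k T u₀ u)
    (hv : ConicalFlow.IsSupersolution ωK η D h s hγ α γ k T v₀ v) :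
    ∀ t ∈ Set.Ioo 0 T, ∀ x : X, u t x - v t x ≤ ⨆ y : X, (u₀ y - v₀ y) :=
  proposition0313003_general hωK.2 hs hγ01.1 hcone hu hv
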